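/- Let $\mathbb D$ be the open unit disc and $\varphi:\mathbb D\to\mathbb D$ an analytic self-map. Assume that $a\in\partial\mathbb D$ is a boundary fixed point of $\varphi$ (that is, $\varphi$ has angular limit $a$ at $a$), that for $w\in\partial\mathbb D$ one has $\limsup_{z\to w}|\varphi(z)|=1$ if and only if $w=a$, and that $\varphi$ has a finite angular derivative $\varphi'(a)$ at $a$ (for some $\eta$ with $|\eta|=1$, the quotient $(\varphi(z)-\eta)/(z-a)$ has the finite angular limit $\varphi'(a)$ at $a$). Let $\psi$ be a bounded analytic function on $\mathbb D$, and assume that, for some $\rho>0$, both $\varphi'$ and $\psi$ are (extended to be) continuous on $\mathbb D\cup(\overline{\mathbb D}\cap B(a,\rho))$, where the value of $\varphi'$ at $a$ is the angular derivative. Let $X$ be one of the following spaces of analytic functions on $\mathbb D$: (i) the weighted Bergman space $A^p_\alpha$, $1\le p<\infty$, $\alpha>-1$, with norm $\|f\|=\bigl(\int_{\mathbb D}|f(z)|^p(1+\alpha)(1-|z|^2)^\alpha\,\frac{dA(z)}{\pi}\bigr)^{1/p}$ ($dA$ is Lebesgue area measure); in this case set $s=\frac{2+\alpha}{p}$ and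 assume that $\varphi$ is univalent; (ii) the space $H^\infty_\alpha$, $\alpha>0$, with norm $\|f\|=\sup_{z\in\mathbb D}|f(z)|(1-|z|^2)^\alpha$; in this case set $s=\alpha$. Then $\varphi'(a)$ is a positive real number, the weighted composition operator $\psi C_\varphi f=\psi\cdot(f\circ\varphi)$ is bounded on $X$, and its essential norm $\|\psi C_\varphi\|_{e,X\to X}$ (the distance in operator norm to the compact operators on $X$) satisfies $$\|\psi C_\varphi\|_{e,X\to X}=\frac{|\psi(a)|}{\varphi'(a)^s}=\limsup_{z\to a}\frac{|\psi(z)|(1-|z|^2)^s}{(1-|\varphi(z)|^2)^s}=\limsup_{|\varphi(z)|\to1}\frac{|\psi(z)|(1-|z|^2)^s}{(1-|\varphi(z)|^2)^s}.$$ -/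

import Mathlib

open Set Filter Topology MeasureTheory

/-- The open unit disc, as a subset of `ℂ`. -/
abbrev unitDisk : Set ℂ := Metric.ball (0 : ℂ) 1

theorem unitDisk_weight_pos (z : unitDisk) : 0 < 1 - ‖(z : ℂ)‖ ^ 2 := by
  have h : ‖(z : ℂ)‖ < 1 := mem_ball_zero_iff.1 z.2
  nlinarith [norm_nonneg (z : ℂ)]

/-- A function on the open unit disc is analytic. -/
def AnalyticInDisk (f : unitDisk → ℂ) : Prop :=
  ∃ F : ℂ → ℂ, DifferentiableOn ℂ F unitDisk ∧ ∀ z : unitDisk, F z = f z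

theorem AnalyticInDisk.continuous {f : unitDisk → ℂ} (hf : AnalyticInDisk f) :
    Continuous f := by
  obtain ⟨F, hF, h⟩ := hf
  have : f = unitDisk.domRestrict F := funext fun z => (h z).symm
  rw [this]
  exact hF.continuousOn.domRestrict

/-- The linear space of analytic functions on the open unit disc. -/
def analyticFunctions : Submodule ℂ (unitDisk → ℂ) where
  carrier := {f | AnalyticInDisk f}
  zero_mem' := ⟨0, differentiableOn_const 0, fun _ => rfl⟩
  add_mem' := by
    rintro f g ⟨F, hF, hf⟩ ⟨G, hG, hg⟩
    exact ⟨F + G, hF.add hG, fun z => by simp [hf z, hg z]⟩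
  smul_mem' := by
    rintro c f ⟨F, hF, hf⟩
    exact ⟨c • F, hF.const_smul c, fun z => by simp [hf z]⟩

/-! ### The standard weighted Bergman spaces -/

/-- The measure `dA_α = (1 + α) (1 - |z|²)^α dA / π` on the unit disc, where `dA` is the
Lebesgue area measure. -/
noncomputable def weightedArea (α : ℝ) : Measure unitDisk :=
  ((volume : Measure ℂ).comap ((↑) : unitDisk → ℂ)).withDensity
    (fun z => ENNReal.ofReal ((1 + α) * (1 - ‖(z : ℂ)‖ ^ 2) ^ α / Real.pi))

theorem bergman_memLp_iff {p α : ℝ} (hp : 1 ≤ p) {f : unitDisk → ℂ} (hf : AnalyticInDisk f) :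
    MemLp f (ENNReal.ofReal p) (weightedArea α) ↔
      Integrable (fun z => ‖f z‖ ^ p) (weightedArea α) := by
  have h0 : ENNReal.ofReal p ≠ 0 := by
    simp only [ne_eq, ENNReal.ofReal_eq_zero, not_le]
    linarith
  have h := integrable_norm_rpow_iff (μ := weightedArea α)
    hf.continuous.aestronglyMeasurable h0 ENNReal.ofReal_ne_top
  rw [ENNReal.toReal_ofReal (by linarith)] at h
  exact h.symm

/-- The analytic functions `f` on the disc with `∫ |f|^p dA_α < ∞`. -/
noncomputable def bergmanSubmodule (p α : ℝ) (hp : 1 ≤ p) : Submodule ℂ (unitDisk → ℂ) where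
  carrier := {f | AnalyticInDisk f ∧ Integrable (fun z => ‖f z‖ ^ p) (weightedArea α)}
  zero_mem' := by
    refine ⟨analyticFunctions.zero_mem, ?_⟩
    have : p ≠ 0 := by linarith
    simp [Real.zero_rpow this]
  add_mem' := by
    rintro f g ⟨hf, hfi⟩ ⟨hg, hgi⟩
    have h := analyticFunctions.add_mem hf hg
    refine ⟨h, ?_⟩
    rw [← bergman_memLp_iff hp h]
    exact ((bergman_memLp_iff hp hf).2 hfi).add ((bergman_memLp_iff hp hg).2 hgi)
  smul_mem' := by
    rintro c f ⟨hf, hfi⟩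
    have h := analyticFunctions.smul_mem c hf
    refine ⟨h, ?_⟩
    rw [← bergman_memLp_iff hp h]
    exact ((bergman_memLp_iff hp hf).2 hfi).const_smul c

/-- The weighted Bergman space `A^p_α`, for `1 ≤ p < ∞` and `α > -1`. -/
def BergmanSpace (p α : ℝ) (hp : 1 ≤ p) (_hα : -1 < α) : Type :=
  bergmanSubmodule p α hp

namespace BergmanSpace

variable {p α : ℝ} {hp : 1 ≤ p} {hα : -1 < α}

noncomputable instance : AddCommGroup (BergmanSpace p α hp hα) :=
  inferInstanceAs (AddCommGroup (bergmanSubmodule p α hp))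

noncomputable instance : Module ℂ (BergmanSpace p α hp hα) :=
  inferInstanceAs (Module ℂ (bergmanSubmodule p α hp))

instance : CoeFun (BergmanSpace p α hp hα) (fun _ => unitDisk → ℂ) :=
  ⟨fun f => f.1⟩

theorem coe_add (f g : BergmanSpace p α hp hα) (z : unitDisk) : (f + g) z = f z + g z := rfl

theorem coe_smul (c : ℂ) (f : BergmanSpace p α hp hα) (z : unitDisk) : (c • f) z = c * f z := rfl

theorem coe_zero (z : unitDisk) : (0 : BergmanSpace p α hp hα) z = 0 := rfl

/-- `‖f‖ = (∫ |f|^p dA_α)^(1/p)`. -/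
noncomputable instance : Norm (BergmanSpace p α hp hα) :=
  ⟨fun f => (∫ z, ‖f z‖ ^ p ∂(weightedArea α)) ^ (1 / p)⟩

theorem norm_def (f : BergmanSpace p α hp hα) :
    ‖f‖ = (∫ z, ‖f z‖ ^ p ∂(weightedArea α)) ^ (1 / p) := rfl

theorem memLp (f : BergmanSpace p α hp hα) :
    MemLp (fun z => f z) (ENNReal.ofReal p) (weightedArea α) :=
  (bergman_memLp_iff hp f.2.1).2 f.2.2

theorem norm_eq_eLpNorm (f : BergmanSpace p α hp hα) :
    ‖f‖ = (eLpNorm (fun z => f z) (ENNReal.ofReal p) (weightedArea α)).toReal := by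
  have h0 : ENNReal.ofReal p ≠ 0 := by
    simp only [ne_eq, ENNReal.ofReal_eq_zero, not_le]
    linarith
  rw [f.memLp.eLpNorm_eq_integral_rpow_norm h0 ENNReal.ofReal_ne_top,
    ENNReal.toReal_ofReal (by positivity), ENNReal.toReal_ofReal (by linarith), norm_def, one_div]

theorem eq_zero_of_norm (f : BergmanSpace p α hp hα) (h : ‖f‖ = 0) : f = 0 := by
  have h0 : ENNReal.ofReal p ≠ 0 := by
    simp only [ne_eq, ENNReal.ofReal_eq_zero, not_le]
    linarith
  rw [norm_eq_eLpNorm, ENNReal.toReal_eq_zero_iff, or_iff_left f.memLp.2.ne,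
    eLpNorm_eq_zero_iff f.memLp.1 h0] at h
  have hc : Continuous (fun z => f z) := f.2.1.continuous
  have hm : Measurable (fun z : unitDisk =>
      ENNReal.ofReal ((1 + α) * (1 - ‖(z : ℂ)‖ ^ 2) ^ α / Real.pi)) := by fun_prop
  have h2 : ∀ᵐ z ∂((volume : Measure ℂ).comap ((↑) : unitDisk → ℂ)), f z = 0 := by
    have h3 := (ae_withDensity_iff hm).1 h
    filter_upwards [h3] with z hz
    refine hz ?_
    have h1 := Real.rpow_pos_of_pos (unitDisk_weight_pos z) α
    have h4 : 0 < 1 + α := by linarith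
    simp only [ne_eq, ENNReal.ofReal_eq_zero, not_le]
    have := Real.pi_pos
    positivity
  have h5 : ∀ᵐ x : ℂ, ∀ hx : x ∈ unitDisk, f ⟨x, hx⟩ = 0 := by
    have h6 := (ae_restrict_iff_subtype (μ := (volume : Measure ℂ)) (s := unitDisk)
      Metric.isOpen_ball.measurableSet (p := fun x => ∀ hx : x ∈ unitDisk, f ⟨x, hx⟩ = 0)).2 (by
        filter_upwards [h2] with z hz
        intro _
        exact hz)
    rw [ae_restrict_iff' Metric.isOpen_ball.measurableSet] at h6
    filter_upwards [h6] with x hx hx2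
    exact hx hx2 hx2
  have hd : Dense {x : ℂ | ∀ hx : x ∈ unitDisk, f ⟨x, hx⟩ = 0} :=
    Measure.dense_of_ae h5
  apply Subtype.ext
  funext z
  by_contra hz
  have ho : IsOpen {y : unitDisk | f y ≠ 0} := isOpen_ne_fun hc continuous_const
  have ho2 : IsOpen (Subtype.val '' {y : unitDisk | f y ≠ 0}) :=
    Metric.isOpen_ball.isOpenMap_subtype_val _ ho
  obtain ⟨x, hx1, hx2⟩ := hd.exists_mem_open ho2 ⟨z, z, hz, rfl⟩
  obtain ⟨y, hy, rfl⟩ := hx2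
  exact hy (hx1 y.2)

theorem core : NormedSpace.Core ℂ (BergmanSpace p α hp hα) where
  norm_nonneg f := by
    rw [norm_eq_eLpNorm]
    exact ENNReal.toReal_nonneg
  norm_smul c f := by
    rw [norm_eq_eLpNorm, norm_eq_eLpNorm]
    have : (fun z => (c • f) z) = c • (fun z => f z) := rfl
    rw [this, eLpNorm_const_smul]
    simp
  norm_triangle f g := by
    rw [norm_eq_eLpNorm, norm_eq_eLpNorm, norm_eq_eLpNorm,
      ← ENNReal.toReal_add f.memLp.2.ne g.memLp.2.ne]
    have h1 : (1 : ENNReal) ≤ ENNReal.ofReal p := by simpa using hp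
    exact ENNReal.toReal_mono (ENNReal.add_ne_top.2 ⟨f.memLp.2.ne, g.memLp.2.ne⟩)
      (eLpNorm_add_le f.memLp.1 g.memLp.1 h1)
  norm_eq_zero_iff f := by
    refine ⟨eq_zero_of_norm f, ?_⟩
    rintro rfl
    have : (fun z => (0 : BergmanSpace p α hp hα) z) = 0 := rfl
    rw [norm_eq_eLpNorm, this]
    simp

noncomputable instance : NormedAddCommGroup (BergmanSpace p α hp hα) :=
  NormedAddCommGroup.ofCore core

noncomputable instance : NormedSpace ℂ (BergmanSpace p α hp hα) :=
  NormedSpace.ofCore core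

end BergmanSpace

/-! ### The weighted spaces `H^∞_α` -/

/-- The analytic functions `f` on the disc with `sup |f(z)| (1 - |z|²)^α < ∞`. -/
noncomputable def korenblumSubmodule (α : ℝ) : Submodule ℂ (unitDisk → ℂ) where
  carrier := {f | AnalyticInDisk f ∧
    BddAbove (range fun z : unitDisk => ‖f z‖ * (1 - ‖(z : ℂ)‖ ^ 2) ^ α)}
  zero_mem' := by
    refine ⟨analyticFunctions.zero_mem, 0, ?_⟩
    rintro _ ⟨z, rfl⟩
    simp
  add_mem' := by
    rintro f g ⟨hf, C, hC⟩ ⟨hg, D, hD⟩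
    refine ⟨analyticFunctions.add_mem hf hg, C + D, ?_⟩
    rintro _ ⟨z, rfl⟩
    have h1 := hC ⟨z, rfl⟩
    have h2 := hD ⟨z, rfl⟩
    have h3 := Real.rpow_pos_of_pos (unitDisk_weight_pos z) α
    have h4 := mul_le_mul_of_nonneg_right (norm_add_le (f z) (g z)) h3.le
    simp only [Pi.add_apply] at *
    linarith
  smul_mem' := by
    rintro c f ⟨hf, C, hC⟩
    refine ⟨analyticFunctions.smul_mem c hf, ‖c‖ * C, ?_⟩
    rintro _ ⟨z, rfl⟩
    have h1 := mul_le_mul_of_nonneg_left (hC ⟨z, rfl⟩) (norm_nonneg c)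
    simpa [mul_assoc] using h1

/-- The weighted Banach space `H^∞_α` of analytic functions. -/
def KorenblumSpace (α : ℝ) : Type := korenblumSubmodule α

namespace KorenblumSpace

variable {α : ℝ}

noncomputable instance : AddCommGroup (KorenblumSpace α) :=
  inferInstanceAs (AddCommGroup (korenblumSubmodule α))

noncomputable instance : Module ℂ (KorenblumSpace α) :=
  inferInstanceAs (Module ℂ (korenblumSubmodule α))

instance : CoeFun (KorenblumSpace α) (fun _ => unitDisk → ℂ) :=
  ⟨fun f => f.1⟩

theorem coe_add (f g : KorenblumSpace α) (z : unitDisk) : (f + g) z = f z + g z := rfl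

theorem coe_smul (c : ℂ) (f : KorenblumSpace α) (z : unitDisk) : (c • f) z = c * f z := rfl

theorem coe_zero (z : unitDisk) : (0 : KorenblumSpace α) z = 0 := rfl

/-- `‖f‖ = sup |f(z)| (1 - |z|²)^α`. -/
noncomputable instance : Norm (KorenblumSpace α) :=
  ⟨fun f => ⨆ z : unitDisk, ‖f z‖ * (1 - ‖(z : ℂ)‖ ^ 2) ^ α⟩

theorem norm_def (f : KorenblumSpace α) :
    ‖f‖ = ⨆ z : unitDisk, ‖f z‖ * (1 - ‖(z : ℂ)‖ ^ 2) ^ α := rfl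

theorem le_norm (f : KorenblumSpace α) (z : unitDisk) :
    ‖f z‖ * (1 - ‖(z : ℂ)‖ ^ 2) ^ α ≤ ‖f‖ :=
  le_ciSup f.2.2 z

theorem core : NormedSpace.Core ℂ (KorenblumSpace α) where
  norm_nonneg f :=
    Real.iSup_nonneg fun z =>
      mul_nonneg (norm_nonneg _) (Real.rpow_pos_of_pos (unitDisk_weight_pos z) α).le
  norm_smul c f := by
    rw [norm_def, norm_def, Real.mul_iSup_of_nonneg (norm_nonneg c)]
    congr 1
    funext z
    rw [coe_smul, norm_mul, mul_assoc]
  norm_triangle f g := by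
    have : Nonempty unitDisk := ⟨⟨0, by simp⟩⟩
    rw [norm_def (f + g)]
    refine ciSup_le fun z => ?_
    have h1 := le_norm f z
    have h2 := le_norm g z
    have h3 := Real.rpow_pos_of_pos (unitDisk_weight_pos z) α
    have h4 := mul_le_mul_of_nonneg_right (norm_add_le (f z) (g z)) h3.le
    rw [coe_add]
    linarith
  norm_eq_zero_iff f := by
    constructor
    · intro h
      apply Subtype.ext
      funext z
      have h1 := le_norm f z
      have h3 := Real.rpow_pos_of_pos (unitDisk_weight_pos z) α
      rw [h] at h1
      have h4 : ‖f z‖ ≤ 0 := by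
        by_contra hc
        push Not at hc
        exact absurd h1 (not_le.2 (mul_pos hc h3))
      exact norm_le_zero_iff.1 h4
    · rintro rfl
      rw [norm_def]
      simp [coe_zero]

noncomputable instance : NormedAddCommGroup (KorenblumSpace α) :=
  NormedAddCommGroup.ofCore core

noncomputable instance : NormedSpace ℂ (KorenblumSpace α) :=
  NormedSpace.ofCore core

end KorenblumSpace

/-! ### Essential norm, angular limits and angular derivatives -/

/-- The essential norm of a bounded operator: its distance to the compact operators. -/
noncomputable def essentialNorm {X Y : Type*} [NormedAddCommGroup X] [NormedSpace ℂ X]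
    [NormedAddCommGroup Y] [NormedSpace ℂ Y] (T : X →L[ℂ] Y) : ℝ :=
  sInf {r : ℝ | ∃ L : X →L[ℂ] Y, IsCompactOperator L ∧ r = ‖T - L‖}

/-- `g` has the angular (nontangential) limit `l` at the boundary point `a`: the limit is `l`
inside every approach region `|z - a| < M (1 - |z|)`. -/
def HasAngularLimit (g : ℂ → ℂ) (a l : ℂ) : Prop :=
  ∀ M : ℝ, 1 < M → Tendsto g (𝓝[{z : ℂ | ‖z - a‖ < M * (1 - ‖z‖)}] a) (𝓝 l)

/-- `φ` has the (finite) angular derivative `c` at the boundary point `a`: for some `η` on the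
unit circle the quotient `(φ(z) - η) / (z - a)` has the angular limit `c` at `a`. -/
def HasAngularDerivAt (φ : ℂ → ℂ) (a c : ℂ) : Prop :=
  ∃ η : ℂ, ‖η‖ = 1 ∧ HasAngularLimit (fun z => (φ z - η) / (z - a)) a c

/-- The quotient `|ψ(z)| (1 - |z|²)^s / (1 - |φ(z)|²)^s`. -/
noncomputable def weightQuotient (φ ψ : ℂ → ℂ) (s : ℝ) (z : ℂ) : ℝ :=
  ‖ψ z‖ * (1 - ‖z‖ ^ 2) ^ s / (1 - ‖φ z‖ ^ 2) ^ s

/-!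
The proof rests on one inequality, shared by the two families of spaces. For `b` in the disc let
`autFactor b` be the modulus of the derivative of the automorphism that exchanges `0` and `b`. In a
space whose norm has conformal weight `s`, every analytic self-map `φ` of the disc satisfies
`‖(autFactor b / autFactor (φ b) ∘ φ) ^ s * |f ∘ φ|‖ ≤ ‖f‖`. For `H^∞_α` this is the Schwarz–Pick
inequality. For `A^p_α` it is Littlewood's subordination principle (`lintegral_comp_le`) after a
change of variables by automorphisms (`lintegral_comp_mul_autFactor_le`).
The inequality is the field `conformal` of the structure `IsConformalNorm`. It contains the
boundedness of composition operators (`b = 0`), the estimate `|f(z)| (1 - |z|²)^s ≤ ‖f‖` (`φ`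
constant), and the fact that the test kernels `testKernel s b`, of modulus `autFactor b ^ s`, have
norm at most one (`f = 1`, `φ = 0`).

Since `φ'` extends continuously to `a`, the quotient `(φ(z) - a) / (z - a)` tends to `c = φ'(a)` for
unrestricted approach to `a`, and `(1 - |φ|²) / (1 - |z|²)` tends to `Re c` along the radius. Letting
`b` tend radially to `a` in the Schwarz–Pick inequality gives Julia's inequality
`|(φ(z) - a) / (z - a)|² / Re c ≤ (1 - |φ(z)|²) / (1 - |z|²)`. It forces `c` to be real and positive,
and with the radial limit it yields the upper limit of the weight quotient at `a`. As `a` is the only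
boundary point at which `|φ|` comes close to `1`, the condition `|φ(z)| → 1` means `z → a`
(`HasBoundaryDeriv.comap_norm_eq`).

Upper estimate (`IsAnalyticSpace.exists_isCompactOperator_norm_sub_le`). Multiply the weight `ψ` by
`1 - q ^ (2 * n)`, where `q` is a function that peaks at `a`. The new weight vanishes at `a`, so by
Montel's theorem the operator is compact. The remaining weight `q ^ (2 * n) * ψ` is small away from
`a`, and near `a` it is at most `|ψ(a)| / c ^ s + ε` times `(|(φ(z) - a) / (z - a)|² / c) ^ s`; the
limit of the conformal inequality as `b → a` (`IsConformalNorm.conformal_boundary`) bounds the norm.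

Lower estimate. Apply `T - L`, with `L` compact, to the test kernels of the points `φ(z)`, `z → a`
radially, and evaluate at `z`: the image under `T` contributes exactly the weight quotient at `z`.
In `A^p_α` every function is `o((1 - |z|²)^(-s))` at the boundary, so the limit points of the images
under `L` contribute nothing (`IsAnalyticSpace.le_norm_sub_of_littleO`). In `H^∞_α` this growth
estimate fails; there the difference of two test kernels at well separated scales still has norm
close to one, and `L` nearly annihilates suitable differences
(`IsAnalyticSpace.le_norm_sub_of_separated`).
-/

/-! ### Disc automorphisms and the Schwarz–Pick inequality -/

/-- The involutive automorphism `z ↦ (b - z) / (1 - conj b * z)` of the unit disc, which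
exchanges `0` and `b`. -/
noncomputable def diskAut (b z : ℂ) : ℂ := (b - z) / (1 - (starRingEnd ℂ) b * z)

/-- The quantity `(1 - |b|²) / |1 - conj b * z|²`, which is the modulus of the derivative of
`diskAut b` at `z`. -/
noncomputable def autFactor (b z : ℂ) : ℝ := (1 - ‖b‖ ^ 2) / ‖1 - (starRingEnd ℂ) b * z‖ ^ 2

theorem one_sub_sq_pos {z : ℂ} (hz : z ∈ unitDisk) : 0 < 1 - ‖z‖ ^ 2 :=
  unitDisk_weight_pos ⟨z, hz⟩

theorem re_one_sub_conj_mul_pos {b z : ℂ} (hb : b ∈ unitDisk) (hz : ‖z‖ ≤ 1) :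
    0 < (1 - (starRingEnd ℂ) b * z).re := by
  have h1 : ‖(starRingEnd ℂ) b * z‖ < 1 := by
    rw [norm_mul, RCLike.norm_conj]
    have := mem_ball_zero_iff.1 hb
    nlinarith [norm_nonneg b, norm_nonneg z]
  have h2 := Complex.re_le_norm ((starRingEnd ℂ) b * z)
  simp only [Complex.sub_re, Complex.one_re]
  linarith

theorem one_sub_conj_mul_ne_zero {b z : ℂ} (hb : b ∈ unitDisk) (hz : ‖z‖ ≤ 1) :
    1 - (starRingEnd ℂ) b * z ≠ 0 := by
  intro h
  have := re_one_sub_conj_mul_pos hb hz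
  simp [h] at this

theorem norm_sq_one_sub_conj_mul (b z : ℂ) :
    ‖1 - (starRingEnd ℂ) b * z‖ ^ 2 - ‖b - z‖ ^ 2 = (1 - ‖b‖ ^ 2) * (1 - ‖z‖ ^ 2) := by
  simp only [← Complex.normSq_eq_norm_sq, Complex.normSq_apply, Complex.sub_re, Complex.sub_im,
    Complex.mul_re, Complex.mul_im, Complex.one_re, Complex.one_im, Complex.conj_re,
    Complex.conj_im]
  ring

theorem autFactor_pos {b z : ℂ} (hb : b ∈ unitDisk) (hz : ‖z‖ ≤ 1) : 0 < autFactor b z := by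
  have h1 := one_sub_sq_pos hb
  have h2 := norm_pos_iff.2 (one_sub_conj_mul_ne_zero hb hz)
  unfold autFactor
  positivity

theorem autFactor_le {b z : ℂ} (hb : b ∈ unitDisk) (hz : ‖z‖ ≤ 1) :
    autFactor b z ≤ (1 - ‖b‖ ^ 2) / (1 - ‖z‖ * ‖b‖) ^ 2 := by
  have hb1 := mem_ball_zero_iff.1 hb
  have h1 : 1 - ‖z‖ * ‖b‖ ≤ ‖1 - (starRingEnd ℂ) b * z‖ := by
    have := norm_sub_norm_le 1 ((starRingEnd ℂ) b * z)
    rw [norm_one, norm_mul, RCLike.norm_conj] at this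
    linarith
  have h2 : 0 < 1 - ‖z‖ * ‖b‖ := by nlinarith [norm_nonneg b]
  have h3 := (one_sub_sq_pos hb).le
  unfold autFactor
  gcongr

theorem one_sub_norm_diskAut_sq {b z : ℂ} (hb : b ∈ unitDisk) (hz : ‖z‖ ≤ 1) :
    1 - ‖diskAut b z‖ ^ 2 = autFactor b z * (1 - ‖z‖ ^ 2) := by
  have h2 := norm_pos_iff.2 (one_sub_conj_mul_ne_zero hb hz)
  have h3 := norm_sq_one_sub_conj_mul b z
  rw [diskAut, autFactor, norm_div, div_mul_eq_mul_div, ← h3, sub_div, div_pow,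
    div_self (by positivity)]

theorem autFactor_self {b : ℂ} (hb : b ∈ unitDisk) : autFactor b b = (1 - ‖b‖ ^ 2)⁻¹ := by
  have h1 := one_sub_sq_pos hb
  have h2 : 1 - (starRingEnd ℂ) b * b = ((1 - ‖b‖ ^ 2 : ℝ) : ℂ) := by
    rw [mul_comm, Complex.mul_conj, Complex.normSq_eq_norm_sq]
    push_cast
    rfl
  rw [autFactor, h2, Complex.norm_real, Real.norm_of_nonneg h1.le]
  field_simp

theorem autFactor_zero (z : ℂ) : autFactor 0 z = 1 := by simp [autFactor]

theorem diskAut_mem {b z : ℂ} (hb : b ∈ unitDisk) (hz : z ∈ unitDisk) :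
    diskAut b z ∈ unitDisk := by
  have hz' := (mem_ball_zero_iff.1 hz).le
  have h := one_sub_norm_diskAut_sq hb hz'
  have := mul_pos (autFactor_pos hb hz') (one_sub_sq_pos hz)
  rw [mem_ball_zero_iff]
  nlinarith [norm_nonneg (diskAut b z)]

theorem one_sub_conj_mul_diskAut {b z : ℂ} (hb : b ∈ unitDisk) (hz : z ∈ unitDisk) :
    1 - (starRingEnd ℂ) b * diskAut b z =
      ((1 - ‖b‖ ^ 2 : ℝ) : ℂ) / (1 - (starRingEnd ℂ) b * z) := by
  have h := one_sub_conj_mul_ne_zero hb (mem_ball_zero_iff.1 hz).le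
  have h2 : (starRingEnd ℂ) b * b = ((‖b‖ ^ 2 : ℝ) : ℂ) := by
    rw [mul_comm, Complex.mul_conj, Complex.normSq_eq_norm_sq]
  rw [diskAut]
  field_simp
  push_cast at h2 ⊢
  linear_combination -h2

theorem diskAut_diskAut {b z : ℂ} (hb : b ∈ unitDisk) (hz : z ∈ unitDisk) :
    diskAut b (diskAut b z) = z := by
  have h := one_sub_conj_mul_ne_zero hb (mem_ball_zero_iff.1 hz).le
  have h1 : ((1 - ‖b‖ ^ 2 : ℝ) : ℂ) ≠ 0 := Complex.ofReal_ne_zero.2 (one_sub_sq_pos hb).ne'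
  have h2 : (starRingEnd ℂ) b * b = ((‖b‖ ^ 2 : ℝ) : ℂ) := by
    rw [mul_comm, Complex.mul_conj, Complex.normSq_eq_norm_sq]
  rw [diskAut, one_sub_conj_mul_diskAut hb hz, diskAut, div_div_eq_mul_div, div_eq_iff h1]
  rw [sub_mul, div_mul_cancel₀ _ h]
  push_cast at h2 ⊢
  linear_combination -z * h2

/-- The chain rule for the involution `diskAut b`, at the level of moduli. -/
theorem autFactor_diskAut {b z : ℂ} (hb : b ∈ unitDisk) (hz : z ∈ unitDisk) :
    autFactor b (diskAut b z) = (autFactor b z)⁻¹ := by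
  have h := norm_pos_iff.2 (one_sub_conj_mul_ne_zero hb (mem_ball_zero_iff.1 hz).le)
  have h1 := one_sub_sq_pos hb
  rw [autFactor, one_sub_conj_mul_diskAut hb hz, autFactor, norm_div, Complex.norm_real,
    Real.norm_of_nonneg h1.le]
  field_simp

theorem hasDerivAt_diskAut {b z : ℂ} (hb : b ∈ unitDisk) (hz : z ∈ unitDisk) :
    HasDerivAt (diskAut b)
      (-((1 - ‖b‖ ^ 2 : ℝ) : ℂ) / (1 - (starRingEnd ℂ) b * z) ^ 2) z := by
  have h := one_sub_conj_mul_ne_zero hb (mem_ball_zero_iff.1 hz).le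
  have h2 : (starRingEnd ℂ) b * b = ((‖b‖ ^ 2 : ℝ) : ℂ) := by
    rw [mul_comm, Complex.mul_conj, Complex.normSq_eq_norm_sq]
  have := ((hasDerivAt_id z).const_sub b).div
    (((hasDerivAt_id z).const_mul ((starRingEnd ℂ) b)).const_sub 1) h
  refine this.congr_deriv ?_
  simp only [id]
  congr 1
  push_cast at h2 ⊢
  linear_combination h2

theorem differentiableOn_diskAut {b : ℂ} (hb : b ∈ unitDisk) :
    DifferentiableOn ℂ (diskAut b) unitDisk := fun _ hz =>
  (hasDerivAt_diskAut hb hz).differentiableAt.differentiableWithinAt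

theorem norm_deriv_diskAut {b z : ℂ} (hb : b ∈ unitDisk) :
    ‖-((1 - ‖b‖ ^ 2 : ℝ) : ℂ) / (1 - (starRingEnd ℂ) b * z) ^ 2‖ = autFactor b z := by
  rw [norm_div, norm_neg, Complex.norm_real, norm_pow,
    Real.norm_of_nonneg (one_sub_sq_pos hb).le, autFactor]

theorem diskAut_zero (b : ℂ) : diskAut b 0 = b := by simp [diskAut]

theorem diskAut_self (b : ℂ) : diskAut b b = 0 := by simp [diskAut]

theorem injOn_diskAut {b : ℂ} (hb : b ∈ unitDisk) : InjOn (diskAut b) unitDisk := by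
  intro x hx y hy h
  rw [← diskAut_diskAut hb hx, h, diskAut_diskAut hb hy]

theorem image_diskAut {b : ℂ} (hb : b ∈ unitDisk) : diskAut b '' unitDisk = unitDisk := by
  ext z
  constructor
  · rintro ⟨w, hw, rfl⟩
    exact diskAut_mem hb hw
  · exact fun hz => ⟨_, diskAut_mem hb hz, diskAut_diskAut hb hz⟩

/-- A self-map of the disc, conjugated by automorphisms so as to fix the origin. -/
noncomputable def centeredMap (φ : ℂ → ℂ) (b z : ℂ) : ℂ := diskAut (φ b) (φ (diskAut b z))

section SelfMap

variable {φ : ℂ → ℂ} {b : ℂ}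

theorem centeredMap_zero (φ : ℂ → ℂ) (b : ℂ) : centeredMap φ b 0 = 0 := by
  rw [centeredMap, diskAut_zero, diskAut_self]

theorem mapsTo_centeredMap (hφ : MapsTo φ unitDisk unitDisk) (hb : b ∈ unitDisk) :
    MapsTo (centeredMap φ b) unitDisk unitDisk := fun _ hz =>
  diskAut_mem (hφ hb) (hφ (diskAut_mem hb hz))

theorem differentiableOn_centeredMap (hφ : MapsTo φ unitDisk unitDisk)
    (hd : DifferentiableOn ℂ φ unitDisk) (hb : b ∈ unitDisk) :
    DifferentiableOn ℂ (centeredMap φ b) unitDisk :=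
  (differentiableOn_diskAut (hφ hb)).comp
    (hd.comp (differentiableOn_diskAut hb) fun _ hz => diskAut_mem hb hz)
    fun _ hz => hφ (diskAut_mem hb hz)

/-- The **Schwarz–Pick inequality**, written with the derivatives of disc automorphisms. -/
theorem schwarzPick (hφ : MapsTo φ unitDisk unitDisk) (hd : DifferentiableOn ℂ φ unitDisk)
    (hb : b ∈ unitDisk) {z : ℂ} (hz : z ∈ unitDisk) :
    autFactor b z * (1 - ‖z‖ ^ 2) ≤ autFactor (φ b) (φ z) * (1 - ‖φ z‖ ^ 2) := by
  have h := Complex.norm_le_norm_of_mapsTo_ball (differentiableOn_centeredMap hφ hd hb)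
    ((mapsTo_centeredMap hφ hb).mono_right Metric.ball_subset_closedBall) (centeredMap_zero φ b)
    (mem_ball_zero_iff.1 (diskAut_mem hb hz))
  rw [centeredMap, diskAut_diskAut hb hz] at h
  rw [← one_sub_norm_diskAut_sq hb (mem_ball_zero_iff.1 hz).le,
    ← one_sub_norm_diskAut_sq (hφ hb) (mem_ball_zero_iff.1 (hφ hz)).le]
  nlinarith [norm_nonneg (diskAut (φ b) (φ z))]

end SelfMap

/-- The normalised kernel `(1 - |b|²)^s / (1 - conj b * z)^(2s)`, whose modulus is
`autFactor b z ^ s`. -/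
noncomputable def testKernel (s : ℝ) (b z : ℂ) : ℂ :=
  (((1 - ‖b‖ ^ 2) ^ s : ℝ) : ℂ) * (1 - (starRingEnd ℂ) b * z) ^ ((-(2 * s) : ℝ) : ℂ)

theorem norm_testKernel {b z : ℂ} (hb : b ∈ unitDisk) (hz : ‖z‖ ≤ 1) (s : ℝ) :
    ‖testKernel s b z‖ = autFactor b z ^ s := by
  have h1 := one_sub_sq_pos hb
  have h2 := norm_pos_iff.2 (one_sub_conj_mul_ne_zero hb hz)
  rw [testKernel, norm_mul, Complex.norm_real, Real.norm_of_nonneg (by positivity),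
    Complex.norm_cpow_real, autFactor, Real.div_rpow h1.le (by positivity),
    Real.rpow_neg h2.le, Real.rpow_mul h2.le, Real.rpow_two, div_eq_mul_inv]

theorem differentiableOn_testKernel {b : ℂ} (hb : b ∈ unitDisk) (s : ℝ) :
    DifferentiableOn ℂ (testKernel s b) unitDisk := by
  refine DifferentiableOn.const_mul (fun z hz => ?_) _
  refine DifferentiableAt.differentiableWithinAt ?_
  refine DifferentiableAt.cpow (by fun_prop) (by fun_prop) (Or.inl ?_)
  exact re_one_sub_conj_mul_pos hb (mem_ball_zero_iff.1 hz).le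

/-- Each test kernel is bounded on the disc, with a bound that depends on its point `b`. -/
theorem exists_norm_testKernel_le {s : ℝ} (hs : 0 < s) {b : ℂ} (hb : b ∈ unitDisk) :
    ∃ D : ℝ, ∀ z ∈ unitDisk, ‖testKernel s b z‖ ≤ D := by
  refine ⟨((1 - ‖b‖ ^ 2) / (1 - ‖b‖) ^ 2) ^ s, fun z hz => ?_⟩
  have hz1 := (mem_ball_zero_iff.1 hz).le
  have hb1 := mem_ball_zero_iff.1 hb
  rw [norm_testKernel hb hz1]
  refine Real.rpow_le_rpow (autFactor_pos hb hz1).le ((autFactor_le hb hz1).trans ?_) hs.le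
  have h3 := (one_sub_sq_pos hb).le
  have h4 : 0 < 1 - ‖b‖ := by linarith
  gcongr
  nlinarith [norm_nonneg b]

/-! ### Littlewood's subordination principle -/

/-- The convex function `x ↦ x ^ p` lies above its tangent at `A`. -/
theorem tangent_le_rpow {p : ℝ} (hp : 1 ≤ p) {A x : ℝ} (hA : 0 < A) (hx : 0 ≤ x) :
    A ^ p + p * A ^ (p - 1) * (x - A) ≤ x ^ p := by
  have h := one_add_mul_self_le_rpow_one_add (s := x / A - 1)
    (by have := div_nonneg hx hA.le; linarith) hp
  have h1 : 1 + (x / A - 1) = x / A := by ring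
  rw [h1, Real.div_rpow hx hA.le, le_div_iff₀ (by positivity)] at h
  refine le_trans (le_of_eq ?_) h
  rw [Real.rpow_sub_one hA.ne']
  field_simp

section Circle

variable {r : ℝ}

theorem herglotzRieszKernel_zero_left (z : ℂ) (hz : z ≠ 0) : herglotzRieszKernel 0 0 z = 1 := by
  simp [herglotzRieszKernel, hz]

theorem re_herglotzRieszKernel_nonneg {w z : ℂ} (hw : w ∈ Metric.ball (0 : ℂ) r)
    (hz : z ∈ Metric.sphere (0 : ℂ) r) : 0 ≤ (herglotzRieszKernel 0 w z).re := by
  have h := congrFun (poissonKernel_eq_re_herglotzRieszKernel (c := 0) (w := w)) z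
  rw [Function.comp_apply] at h
  rw [← h, poissonKernel_def]
  rw [mem_ball_zero_iff] at hw
  rw [mem_sphere_zero_iff_norm] at hz
  refine div_nonneg ?_ (by positivity)
  simp only [sub_zero, hz]
  nlinarith [norm_nonneg w]

/-- The Poisson kernel has average one. -/
theorem circleAverage_re_kernel (hr : 0 < r) {w : ℂ} (hw : w ∈ Metric.ball (0 : ℂ) r) :
    Real.circleAverage (fun z => (herglotzRieszKernel 0 w z).re) 0 r = 1 := by
  have h := DiffContOnCl.circleAverage_re_herglotzRieszKernel_smul (f := fun _ : ℂ => (1 : ℂ))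
    (R := r) (c := 0) (w := w) diffContOnCl_const hw
  have h2 := congrArg Complex.re h
  rw [← Complex.reCLM_apply, ← Complex.reCLM.circleAverage_comp_comm] at h2
  · simpa [Function.comp_def] using h2
  · refine ContinuousOn.circleIntegrable hr.le (ContinuousOn.smul ?_ continuousOn_const)
    have := continuousOn_herglotzRieszKernel_sphere hw
    rw [abs_of_pos hr] at this
    exact Complex.continuous_re.comp_continuousOn this

/-- Jensen's inequality for the Poisson integral: `|g|^p` is dominated inside a circle by the
Poisson integral of its boundary values. -/
theorem norm_rpow_le_poisson {p : ℝ} (hp : 1 ≤ p) (hr : 0 < r) {g : ℂ → ℂ}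
    (hg : DiffContOnCl ℂ g (Metric.ball 0 r)) {w : ℂ} (hw : w ∈ Metric.ball (0 : ℂ) r) :
    ‖g w‖ ^ p ≤
      Real.circleAverage (fun z => (herglotzRieszKernel 0 w z).re * ‖g z‖ ^ p) 0 r := by
  have hK : ContinuousOn (fun z => (herglotzRieszKernel 0 w z).re) (Metric.sphere 0 r) := by
    have := continuousOn_herglotzRieszKernel_sphere hw
    rw [abs_of_pos hr] at this
    exact Complex.continuous_re.comp_continuousOn this
  have hgc : ContinuousOn g (Metric.sphere 0 r) :=
    hg.continuousOn_ball.mono Metric.sphere_subset_closedBall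
  have hgp : ContinuousOn (fun z => ‖g z‖ ^ p) (Metric.sphere 0 r) :=
    hgc.norm.rpow_const fun _ _ => Or.inr (by linarith)
  have hnn : ∀ z ∈ Metric.sphere (0 : ℂ) |r|, 0 ≤ (herglotzRieszKernel 0 w z).re := by
    rw [abs_of_pos hr]
    exact fun z hz => re_herglotzRieszKernel_nonneg hw hz
  rcases (norm_nonneg (g w)).eq_or_lt' with h0 | h0
  · rw [h0, Real.zero_rpow (by linarith)]
    exact Real.circleAverage_nonneg_of_nonneg fun z hz => mul_nonneg (hnn z hz) (by positivity)
  set A := ‖g w‖ with hA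
  have h1 : A ≤ Real.circleAverage (fun z => (herglotzRieszKernel 0 w z).re * ‖g z‖) 0 r := by
    have h := DiffContOnCl.circleAverage_re_herglotzRieszKernel_smul hg hw
    rw [hA, ← h, Real.circleAverage_def, Real.circleAverage_def, norm_smul, smul_eq_mul,
      Real.norm_of_nonneg (by positivity)]
    refine mul_le_mul_of_nonneg_left ?_ (by positivity)
    refine (intervalIntegral.norm_integral_le_integral_norm (by positivity)).trans (le_of_eq ?_)
    refine intervalIntegral.integral_congr fun θ _ => ?_
    simp only [Pi.smul_apply', Function.comp_apply, norm_smul]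
    rw [Real.norm_of_nonneg (hnn _ (circleMap_mem_sphere' 0 r θ))]
  have i1 := ContinuousOn.circleIntegrable hr.le hK
  have i2 := ContinuousOn.circleIntegrable hr.le (hK.mul hgc.norm)
  have i3 := ContinuousOn.circleIntegrable hr.le (hK.mul hgp)
  -- Jensen's inequality: integrate the tangent inequality at `A` against the Poisson kernel.
  set B := p * A ^ (p - 1) with hB
  have hB0 : 0 ≤ B := by positivity
  have j1 : CircleIntegrable (fun z => (A ^ p - B * A) • (herglotzRieszKernel 0 w z).re) 0 r :=
    i1.const_smul
  have j2 : CircleIntegrable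
      (fun z => B • ((herglotzRieszKernel 0 w z).re * ‖g z‖)) 0 r := i2.const_smul
  have h2 : Real.circleAverage (fun z => (A ^ p - B * A) • (herglotzRieszKernel 0 w z).re +
      B • ((herglotzRieszKernel 0 w z).re * ‖g z‖)) 0 r ≤
      Real.circleAverage (fun z => (herglotzRieszKernel 0 w z).re * ‖g z‖ ^ p) 0 r := by
    refine Real.circleAverage_mono (j1.add j2) i3 fun z hz => ?_
    have := mul_le_mul_of_nonneg_left (tangent_le_rpow hp h0 (norm_nonneg (g z))) (hnn z hz)
    simp only [smul_eq_mul]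
    linarith
  rw [Real.circleAverage_fun_add j1 j2, Real.circleAverage_fun_smul, Real.circleAverage_fun_smul,
      circleAverage_re_kernel hr hw] at h2
  have h3 := mul_le_mul_of_nonneg_left h1 hB0
  simp only [smul_eq_mul] at h2
  linarith

theorem circleAverage_circleAverage_swap (hr : 0 < r) {F : ℂ → ℂ → ℝ}
    (hF : ContinuousOn (Function.uncurry F) (Metric.sphere 0 r ×ˢ Metric.sphere 0 r)) :
    Real.circleAverage (fun z => Real.circleAverage (fun t => F z t) 0 r) 0 r =
      Real.circleAverage (fun t => Real.circleAverage (fun z => F z t) 0 r) 0 r := by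
  simp only [Real.circleAverage_def, smul_eq_mul, intervalIntegral.integral_const_mul]
  congr 2
  refine intervalIntegral_intervalIntegral_swap
    (F := fun x y => F (circleMap 0 r x) (circleMap 0 r y)) ?_
  have hc : Continuous (Function.uncurry fun x y => F (circleMap 0 r x) (circleMap 0 r y)) :=
    hF.comp_continuous (f := fun q : ℝ × ℝ => (circleMap 0 r q.1, circleMap 0 r q.2))
      (by fun_prop) fun q => ⟨circleMap_mem_sphere 0 hr.le _, circleMap_mem_sphere 0 hr.le _⟩
  exact (hc.continuousOn.integrableOn_compact
    (isCompact_uIcc.prod isCompact_uIcc)).mono_set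
      (prod_mono uIoc_subset_uIcc uIoc_subset_uIcc)

/-- **Littlewood's inequality** on a circle which the self-map takes into the open disc it
bounds. -/
theorem circleAverage_comp_le {p : ℝ} (hp : 1 ≤ p) (hr : 0 < r) {g ω : ℂ → ℂ}
    (hg : DiffContOnCl ℂ g (Metric.ball 0 r)) (hω : DiffContOnCl ℂ ω (Metric.ball 0 r))
    (h0 : ω 0 = 0) (hm : MapsTo ω (Metric.closedBall 0 r) (Metric.ball 0 r)) :
    Real.circleAverage (fun z => ‖g (ω z)‖ ^ p) 0 r ≤
      Real.circleAverage (fun z => ‖g z‖ ^ p) 0 r := by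
  have hms : MapsTo ω (Metric.sphere 0 r) (Metric.ball 0 r) :=
    hm.mono_left Metric.sphere_subset_closedBall
  have hgc : ContinuousOn g (Metric.sphere 0 r) :=
    hg.continuousOn_ball.mono Metric.sphere_subset_closedBall
  have hgp : ContinuousOn (fun z => ‖g z‖ ^ p) (Metric.sphere 0 r) :=
    hgc.norm.rpow_const fun _ _ => Or.inr (by linarith)
  have hωc : ContinuousOn ω (Metric.sphere 0 r) :=
    hω.continuousOn_ball.mono Metric.sphere_subset_closedBall
  have hne : ∀ w ∈ Metric.ball (0 : ℂ) r, ∀ t ∈ Metric.sphere (0 : ℂ) r, t - w ≠ 0 := by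
    intro w hw t ht h
    rw [mem_ball_zero_iff] at hw
    rw [mem_sphere_zero_iff_norm] at ht
    rw [sub_eq_zero] at h
    rw [h] at ht
    linarith
  have hF : ContinuousOn (Function.uncurry fun z t =>
      (herglotzRieszKernel 0 (ω z) t).re * ‖g t‖ ^ p)
      (Metric.sphere 0 r ×ˢ Metric.sphere 0 r) := by
    have h1 : ContinuousOn (fun q : ℂ × ℂ => ω q.1)
        (Metric.sphere 0 r ×ˢ Metric.sphere 0 r) :=
      hωc.comp continuousOn_fst fun q hq => hq.1
    have h2 : ContinuousOn (fun q : ℂ × ℂ => ‖g q.2‖ ^ p)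
        (Metric.sphere 0 r ×ˢ Metric.sphere 0 r) :=
      hgp.comp continuousOn_snd fun q hq => hq.2
    refine ContinuousOn.mul (Complex.continuous_re.comp_continuousOn ?_) h2
    simp only [herglotzRieszKernel_def, sub_zero]
    exact (continuousOn_snd.add h1).div (continuousOn_snd.sub h1)
      fun q hq => hne _ (hms hq.1) _ hq.2
  have key : Real.circleAverage (fun z => ‖g (ω z)‖ ^ p) 0 r ≤
      Real.circleAverage (fun z => Real.circleAverage (fun t =>
        (herglotzRieszKernel 0 (ω z) t).re * ‖g t‖ ^ p) 0 r) 0 r := by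
    refine Real.circleAverage_mono ?_ ?_ fun z hz => ?_
    · refine ContinuousOn.circleIntegrable hr.le ?_
      exact ((hg.continuousOn_ball.comp hωc
        (hms.mono_right Metric.ball_subset_closedBall)).norm.rpow_const
        fun _ _ => Or.inr (by linarith))
    · have hc : Continuous (Function.uncurry fun x y : ℝ =>
          (herglotzRieszKernel 0 (ω (circleMap 0 r x)) (circleMap 0 r y)).re *
            ‖g (circleMap 0 r y)‖ ^ p) :=
        hF.comp_continuous (f := fun q : ℝ × ℝ => (circleMap 0 r q.1, circleMap 0 r q.2))
          (by fun_prop)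
          fun q => ⟨circleMap_mem_sphere 0 hr.le _, circleMap_mem_sphere 0 hr.le _⟩
      refine Continuous.intervalIntegrable ?_ _ _
      simp only [Real.circleAverage_def, smul_eq_mul]
      have h5 := intervalIntegral.continuous_parametric_intervalIntegral_of_continuous'
        (μ := volume) hc 0 (2 * Real.pi)
      exact (continuous_const (y := (2 * Real.pi)⁻¹)).mul h5
    · rw [abs_of_pos hr] at hz
      exact norm_rpow_le_poisson hp hr hg (hms hz)
  -- For fixed `t` the kernel at `ω z` is harmonic in `z`, so its average is its value at `ω 0 = 0`.
  refine key.trans (le_of_eq ?_)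
  rw [circleAverage_circleAverage_swap hr hF]
  refine Real.circleAverage_congr_sphere fun t ht => ?_
  rw [abs_of_pos hr] at ht
  have h1 : Real.circleAverage (fun z => (herglotzRieszKernel 0 (ω z) t).re) 0 r = 1 := by
    have hd : DiffContOnCl ℂ (fun z => herglotzRieszKernel 0 (ω z) t) (Metric.ball 0 |r|) := by
      rw [abs_of_pos hr]
      have e : (fun z => herglotzRieszKernel 0 (ω z) t) = fun z => (t + ω z) * (t - ω z)⁻¹ := by
        funext z
        simp [herglotzRieszKernel_def, div_eq_mul_inv]
      rw [e]
      have hcl : ∀ z ∈ closure (Metric.ball (0 : ℂ) r), t - ω z ≠ 0 := by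
        intro z hz
        rw [closure_ball _ hr.ne'] at hz
        exact hne _ (hm hz) _ ht
      exact (diffContOnCl_const.add hω).smul ((diffContOnCl_const.sub hω).inv hcl)
    have h2 := congrArg Complex.re hd.circleAverage
    rw [← Complex.reCLM_apply, ← Complex.reCLM.circleAverage_comp_comm] at h2
    · rw [h0, herglotzRieszKernel_zero_left] at h2
      · simpa [Function.comp_def] using h2
      · rintro rfl
        simp at ht
        exact hr.ne ht
    · refine ContinuousOn.circleIntegrable hr.le (hd.continuousOn.mono ?_)
      rw [abs_of_pos hr, closure_ball _ hr.ne']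
      exact Metric.sphere_subset_closedBall
  have h3 : (fun z => (herglotzRieszKernel 0 (ω z) t).re * ‖g t‖ ^ p) =
      fun z => (‖g t‖ ^ p) • (herglotzRieszKernel 0 (ω z) t).re := by
    funext z
    rw [smul_eq_mul, mul_comm]
  simp only [h3]
  rw [Real.circleAverage_fun_smul, h1, smul_eq_mul, mul_one]

end Circle

theorem lintegral_Ioo_circle {r : ℝ} (hr : 0 < r) {h : ℂ → ℝ}
    (hh : ContinuousOn h (Metric.sphere 0 r)) (h0 : ∀ z, 0 ≤ h z) :
    ∫⁻ θ in Ioo (-Real.pi) Real.pi, ENNReal.ofReal (h (circleMap 0 r θ)) =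
      ENNReal.ofReal (2 * Real.pi * Real.circleAverage h 0 r) := by
  have hc : Continuous fun θ => h (circleMap 0 r θ) :=
    hh.comp_continuous (by fun_prop) fun θ => circleMap_mem_sphere 0 hr.le θ
  have hpi := Real.pi_pos
  rw [← ofReal_integral_eq_lintegral_ofReal
      ((hc.integrableOn_Icc (a := -Real.pi) (b := Real.pi)).mono_set Ioo_subset_Icc_self)
      (Eventually.of_forall fun θ => h0 _),
    ← integral_Ioc_eq_integral_Ioo, ← intervalIntegral.integral_of_le (by linarith),
    Real.circleAverage_eq_integral_add (-Real.pi),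
    intervalIntegral.integral_comp_add_right (fun θ => h (circleMap 0 r θ)), smul_eq_mul]
  congr 1
  field_simp
  congr 1 <;> ring

theorem polarCoord_symm_eq_circleMap (r θ : ℝ) :
    Complex.polarCoord.symm (r, θ) = circleMap 0 r θ := by
  rw [Complex.polarCoord_symm_apply, circleMap_zero, Complex.exp_mul_I]
  push_cast
  rfl

/-- Integration of a function over the disc in polar coordinates, against a radial weight. -/
theorem lintegral_unitDisk_polar {h : ℂ → ℝ} (hh : ContinuousOn h unitDisk) (h0 : ∀ z, 0 ≤ h z)
    {W : ℝ → ENNReal} (hW : Measurable W) :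
    ∫⁻ z in unitDisk, ENNReal.ofReal (h z) * W ‖z‖ =
      ∫⁻ r in Ioo (0 : ℝ) 1, ENNReal.ofReal r * W r *
        ENNReal.ofReal (2 * Real.pi * Real.circleAverage h 0 r) := by
  have hD : MeasurableSet unitDisk := Metric.isOpen_ball.measurableSet
  classical
  have hm : Measurable (unitDisk.indicator fun z => ENNReal.ofReal (h z) * W ‖z‖) := by
    have h1 : Measurable (unitDisk.indicator h) := by
      have := hh.measurable_piecewise (g := fun _ => (0 : ℝ)) continuousOn_const hD
      exact piecewise_eq_indicator (s := unitDisk) (f := h) ▸ this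
    have h2 : (unitDisk.indicator fun z => ENNReal.ofReal (h z) * W ‖z‖) =
        fun z => ENNReal.ofReal (unitDisk.indicator h z) * W ‖z‖ := by
      funext z
      by_cases hz : z ∈ unitDisk <;> simp [hz]
    rw [h2]
    exact (ENNReal.measurable_ofReal.comp h1).mul (hW.comp measurable_norm)
  rw [← lintegral_indicator hD, ← Complex.lintegral_comp_polarCoord_symm,
    show polarCoord.target = Ioi (0 : ℝ) ×ˢ Ioo (-Real.pi) Real.pi from rfl,
    Measure.volume_eq_prod, ← Measure.prod_restrict]
  have hm2 : Measurable fun q : ℝ × ℝ => ENNReal.ofReal q.1 •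
      unitDisk.indicator (fun z => ENNReal.ofReal (h z) * W ‖z‖)
        (Complex.polarCoord.symm q) := by
    have e : (fun q : ℝ × ℝ => Complex.polarCoord.symm q) = fun q => circleMap 0 q.1 q.2 := by
      funext q
      exact polarCoord_symm_eq_circleMap q.1 q.2
    have h3 : Measurable fun q : ℝ × ℝ => Complex.polarCoord.symm q := by
      rw [e]
      exact Continuous.measurable (by unfold circleMap; fun_prop)
    exact (ENNReal.measurable_ofReal.comp measurable_fst).smul (hm.comp h3)
  rw [lintegral_prod _ hm2.aemeasurable, ← lintegral_indicator measurableSet_Ioi,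
    ← lintegral_indicator measurableSet_Ioo]
  congr 1
  funext r
  by_cases hr : r ∈ Ioo (0 : ℝ) 1
  · have hr0 : r ∈ Ioi (0 : ℝ) := hr.1
    rw [indicator_of_mem hr, indicator_of_mem hr0]
    have hmem : ∀ θ, circleMap 0 r θ ∈ unitDisk := fun θ => by
      rw [mem_ball_zero_iff, norm_circleMap_zero, abs_of_pos hr.1]
      exact hr.2
    simp only [polarCoord_symm_eq_circleMap, indicator_of_mem (hmem _), norm_circleMap_zero,
      abs_of_pos hr.1, smul_eq_mul]
    have hsub : Metric.sphere (0 : ℂ) r ⊆ unitDisk := fun z hz => by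
      rw [mem_ball_zero_iff, mem_sphere_zero_iff_norm.1 hz]
      exact hr.2
    rw [← lintegral_Ioo_circle hr.1 (hh.mono hsub) h0]
    have hmeas : Measurable fun θ => ENNReal.ofReal (h (circleMap 0 r θ)) :=
      ENNReal.measurable_ofReal.comp
        (hh.comp_continuous (by fun_prop) hmem).measurable
    rw [← lintegral_const_mul _ hmeas]
    refine lintegral_congr fun θ => ?_
    ring
  · rw [indicator_of_notMem hr]
    by_cases hr0 : r ∈ Ioi (0 : ℝ)
    · rw [indicator_of_mem hr0]
      have hmem : ∀ θ, circleMap 0 r θ ∉ unitDisk := fun θ h => by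
        rw [mem_ball_zero_iff, norm_circleMap_zero, abs_of_pos hr0] at h
        exact hr ⟨hr0, h⟩
      simp only [polarCoord_symm_eq_circleMap, indicator_of_notMem (hmem _), smul_zero,
        lintegral_zero]
    · rw [indicator_of_notMem hr0]

/-- Littlewood's subordination principle for a radial weight, for a strict self-map. -/
theorem lintegral_comp_le_of_norm_lt {p : ℝ} (hp : 1 ≤ p) {g ω : ℂ → ℂ}
    (hg : DifferentiableOn ℂ g unitDisk) (hω : DifferentiableOn ℂ ω unitDisk)
    (h0 : ω 0 = 0) (hlt : ∀ z ∈ unitDisk, z ≠ 0 → ‖ω z‖ < ‖z‖)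
    {W : ℝ → ENNReal} (hW : Measurable W) :
    ∫⁻ z in unitDisk, ENNReal.ofReal (‖g (ω z)‖ ^ p) * W ‖z‖ ≤
      ∫⁻ z in unitDisk, ENNReal.ofReal (‖g z‖ ^ p) * W ‖z‖ := by
  have hp0 : 0 ≤ p := by linarith
  have hmaps : MapsTo ω unitDisk unitDisk := by
    intro z hz
    by_cases h : z = 0
    · rw [h, h0]
      simp
    · rw [mem_ball_zero_iff] at hz ⊢
      exact (hlt z (mem_ball_zero_iff.2 hz) h).trans hz
  rw [lintegral_unitDisk_polar (h := fun z => ‖g (ω z)‖ ^ p)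
      ((hg.continuousOn.comp hω.continuousOn hmaps).norm.rpow_const fun _ _ => Or.inr hp0)
      (fun z => by positivity) hW,
    lintegral_unitDisk_polar (hg.continuousOn.norm.rpow_const fun _ _ => Or.inr hp0)
      (fun z => by positivity) hW]
  refine setLIntegral_mono' measurableSet_Ioo fun r hr => ?_
  refine mul_le_mul_right (ENNReal.ofReal_le_ofReal ?_) _
  have hsub : Metric.closedBall (0 : ℂ) r ⊆ unitDisk :=
    Metric.closedBall_subset_ball hr.2
  refine mul_le_mul_of_nonneg_left ?_ (by positivity)
  refine circleAverage_comp_le hp hr.1 (hg.diffContOnCl_ball hsub) (hω.diffContOnCl_ball hsub)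
    h0 fun z hz => ?_
  rw [mem_ball_zero_iff]
  by_cases h : z = 0
  · rw [h, h0, norm_zero]
    exact hr.1
  · exact (hlt z (hsub hz) h).trans_le (mem_closedBall_zero_iff.1 hz)

/-- **Littlewood's subordination principle** for a radial weight on the disc. -/
theorem lintegral_comp_le {p : ℝ} (hp : 1 ≤ p) {g ω : ℂ → ℂ}
    (hg : DifferentiableOn ℂ g unitDisk) (hω : DifferentiableOn ℂ ω unitDisk)
    (h0 : ω 0 = 0) (hm : MapsTo ω unitDisk unitDisk) {W : ℝ → ENNReal} (hW : Measurable W)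
    (hWt : ∀ x, W x ≠ ⊤) :
    ∫⁻ z in unitDisk, ENNReal.ofReal (‖g (ω z)‖ ^ p) * W ‖z‖ ≤
      ∫⁻ z in unitDisk, ENNReal.ofReal (‖g z‖ ^ p) * W ‖z‖ := by
  have hp0 : 0 ≤ p := by linarith
  have hD : MeasurableSet unitDisk := Metric.isOpen_ball.measurableSet
  -- A rotation is no strict self-map, hence the dilations `t • ω` with `t < 1`, and Fatou's lemma.
  let t : ℕ → ℝ := fun n => 1 - 1 / ((n : ℝ) + 2)
  have ht0 : ∀ n, 0 < t n := fun n => by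
    have : 1 / ((n : ℝ) + 2) < 1 := by
      rw [div_lt_one (by positivity)]
      have : (0 : ℝ) ≤ n := by positivity
      linarith
    simp only [t]
    linarith
  have ht1 : ∀ n, t n < 1 := fun n => by
    have : 0 < 1 / ((n : ℝ) + 2) := by positivity
    simp only [t]
    linarith
  have htl : Tendsto t atTop (𝓝 1) := by
    have h1 : Tendsto (fun n : ℕ => 1 / ((n : ℝ) + 2)) atTop (𝓝 0) := by
      simp only [one_div]
      exact tendsto_inv_atTop_zero.comp
        (tendsto_atTop_add_const_right _ _ tendsto_natCast_atTop_atTop)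
    simpa [t] using h1.const_sub 1
  have hle : ∀ z ∈ unitDisk, ‖ω z‖ ≤ ‖z‖ := fun z hz =>
    Complex.norm_le_norm_of_mapsTo_ball hω (hm.mono_right Metric.ball_subset_closedBall) h0
      (mem_ball_zero_iff.1 hz)
  have hmt : ∀ n, MapsTo (fun z => (t n : ℂ) * ω z) unitDisk unitDisk := fun n z hz => by
    have h1 := mem_ball_zero_iff.1 (hm hz)
    rw [mem_ball_zero_iff, norm_mul, Complex.norm_real, Real.norm_of_nonneg (ht0 n).le]
    nlinarith [norm_nonneg (ω z), ht1 n]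
  have hlim : ∀ z ∈ unitDisk, Tendsto
      (fun n => ENNReal.ofReal (‖g ((t n : ℂ) * ω z)‖ ^ p) * W ‖z‖) atTop
      (𝓝 (ENNReal.ofReal (‖g (ω z)‖ ^ p) * W ‖z‖)) := fun z hz => by
    have h1 : Tendsto (fun n => (t n : ℂ) * ω z) atTop (𝓝 (ω z)) := by
      have := ((Complex.continuous_ofReal.tendsto 1).comp htl).mul_const (ω z)
      simpa using this
    have h2 : ContinuousAt g (ω z) :=
      (hg.differentiableAt (Metric.isOpen_ball.mem_nhds (hm hz))).continuousAt
    have h3 := ((h2.tendsto.comp h1).norm.rpow_const (Or.inr hp0) : Tendsto _ _ (𝓝 (_ ^ p)))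
    exact ENNReal.Tendsto.mul_const (ENNReal.tendsto_ofReal h3) (Or.inr (hWt _))
  have hmeas : ∀ n, AEMeasurable
      (fun z => ENNReal.ofReal (‖g ((t n : ℂ) * ω z)‖ ^ p) * W ‖z‖)
      (volume.restrict unitDisk) := fun n => by
    have h1 : ContinuousOn (fun z => ‖g ((t n : ℂ) * ω z)‖ ^ p) unitDisk :=
      ((hg.continuousOn.comp (hω.continuousOn.const_mul _) (hmt n)).norm.rpow_const
        fun _ _ => Or.inr hp0)
    exact (ENNReal.measurable_ofReal.comp_aemeasurable (h1.aemeasurable hD)).mul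
      (hW.comp measurable_norm).aemeasurable
  calc ∫⁻ z in unitDisk, ENNReal.ofReal (‖g (ω z)‖ ^ p) * W ‖z‖
      = ∫⁻ z in unitDisk, liminf
          (fun n => ENNReal.ofReal (‖g ((t n : ℂ) * ω z)‖ ^ p) * W ‖z‖) atTop :=
        setLIntegral_congr_fun hD fun z hz => (hlim z hz).liminf_eq.symm
    _ ≤ liminf (fun n => ∫⁻ z in unitDisk,
          ENNReal.ofReal (‖g ((t n : ℂ) * ω z)‖ ^ p) * W ‖z‖) atTop :=
        lintegral_liminf_le' hmeas
    _ ≤ _ := by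
        refine liminf_le_of_frequently_le' (Frequently.of_forall fun n => ?_)
        refine lintegral_comp_le_of_norm_lt hp hg (hω.const_mul _) (by simp [h0])
          (fun z hz hz0 => ?_) hW
        have h1 := hle z hz
        have h2 := norm_pos_iff.2 hz0
        rw [norm_mul, Complex.norm_real, Real.norm_of_nonneg (ht0 n).le]
        nlinarith [norm_nonneg (ω z), ht1 n, ht0 n]

/-! ### Conformal invariance of weighted area integrals -/

/-- Multiplication by `c` scales area by `|c|²`. -/
theorem abs_det_toSpanSingleton (c : ℂ) :
    |((ContinuousLinearMap.toSpanSingleton ℂ c).restrictScalars ℝ).det| = ‖c‖ ^ (2 : ℝ) := by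
  simp [ContinuousLinearMap.det, LinearMap.det_restrictScalars, Algebra.norm_complex_apply,
    Complex.normSq_eq_norm_sq]

/-- Change of variables by a disc automorphism. -/
theorem lintegral_comp_diskAut {b : ℂ} (hb : b ∈ unitDisk) (α : ℝ) (H : ℂ → ENNReal) :
    ∫⁻ z in unitDisk, H z * ENNReal.ofReal ((1 - ‖z‖ ^ 2) ^ α) =
      ∫⁻ z in unitDisk, H (diskAut b z) *
        ENNReal.ofReal (autFactor b z ^ (2 + α) * (1 - ‖z‖ ^ 2) ^ α) := by
  have hD : MeasurableSet unitDisk := Metric.isOpen_ball.measurableSet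
  conv_lhs => rw [← image_diskAut hb]
  rw [lintegral_image_eq_lintegral_abs_det_fderiv_mul volume hD
    (fun z hz => ((hasDerivAt_diskAut hb hz).hasFDerivAt.restrictScalars ℝ).hasFDerivWithinAt)
    (injOn_diskAut hb)]
  refine setLIntegral_congr_fun hD fun z hz => ?_
  have hz1 := (mem_ball_zero_iff.1 hz).le
  have hpos := autFactor_pos hb hz1
  have hdet : |((ContinuousLinearMap.toSpanSingleton ℂ
      (-((1 - ‖b‖ ^ 2 : ℝ) : ℂ) / (1 - (starRingEnd ℂ) b * z) ^ 2)).restrictScalars ℝ).det| =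
      autFactor b z ^ (2 : ℝ) := by
    rw [← norm_deriv_diskAut hb]
    exact abs_det_toSpanSingleton _
  simp only [hdet]
  rw [one_sub_norm_diskAut_sq hb hz1, Real.mul_rpow hpos.le (one_sub_sq_pos hz).le,
    Real.rpow_add hpos, mul_assoc (autFactor b z ^ (2 : ℝ)),
    ENNReal.ofReal_mul (by positivity : 0 ≤ autFactor b z ^ (2 : ℝ))]
  ring

/-- The sharp weighted subordination inequality, normalised at a point `b` of the disc: the change
of variables by automorphisms turns it into Littlewood's principle for the self-map
`centeredMap φ b`, which fixes the origin. -/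
theorem lintegral_comp_mul_autFactor_le {p α s : ℝ} (hp : 1 ≤ p) (hs : s = (2 + α) / p)
    {f φ : ℂ → ℂ} (hf : DifferentiableOn ℂ f unitDisk) (hφ : MapsTo φ unitDisk unitDisk)
    (hd : DifferentiableOn ℂ φ unitDisk) {b : ℂ} (hb : b ∈ unitDisk) :
    ∫⁻ z in unitDisk, ENNReal.ofReal
        (((autFactor b z / autFactor (φ b) (φ z)) ^ s * ‖f (φ z)‖) ^ p) *
        ENNReal.ofReal ((1 - ‖z‖ ^ 2) ^ α) ≤
      ∫⁻ z in unitDisk, ENNReal.ofReal (‖f z‖ ^ p) * ENNReal.ofReal ((1 - ‖z‖ ^ 2) ^ α) := by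
  have hD : MeasurableSet unitDisk := Metric.isOpen_ball.measurableSet
  have hp0 : p ≠ 0 := by linarith
  have hsp : s * p = 2 + α := by rw [hs]; field_simp
  set b' := φ b with hb'
  have hb'm : b' ∈ unitDisk := hφ hb
  let g : ℂ → ℂ := fun w => testKernel s b' w * f (diskAut b' w)
  have hg : DifferentiableOn ℂ g unitDisk := (differentiableOn_testKernel hb'm s).mul
    (hf.comp (differentiableOn_diskAut hb'm) fun _ hz => diskAut_mem hb'm hz)
  have hgn : ∀ w ∈ unitDisk, ‖g w‖ ^ p = ‖f (diskAut b' w)‖ ^ p * autFactor b' w ^ (2 + α) := by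
    intro w hw
    have hw1 := (mem_ball_zero_iff.1 hw).le
    rw [norm_mul, norm_testKernel hb'm hw1, Real.mul_rpow
      (Real.rpow_nonneg (autFactor_pos hb'm hw1).le _) (norm_nonneg _),
      ← Real.rpow_mul (autFactor_pos hb'm hw1).le, hsp, mul_comm]
  rw [lintegral_comp_diskAut hb, lintegral_comp_diskAut hb'm]
  have e1 : ∀ z ∈ unitDisk, ENNReal.ofReal (((autFactor b (diskAut b z) /
      autFactor b' (φ (diskAut b z))) ^ s * ‖f (φ (diskAut b z))‖) ^ p) *
      ENNReal.ofReal (autFactor b z ^ (2 + α) * (1 - ‖z‖ ^ 2) ^ α) =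
      ENNReal.ofReal (‖g (centeredMap φ b z)‖ ^ p) *
        ENNReal.ofReal ((1 - ‖z‖ ^ 2) ^ α) := by
    intro z hz
    have hz1 := (mem_ball_zero_iff.1 hz).le
    have hσ := diskAut_mem hb hz
    have hφσ := hφ hσ
    have hω := mapsTo_centeredMap hφ hb hz
    have hω1 := (mem_ball_zero_iff.1 hω).le
    have hpos := autFactor_pos hb hz1
    have hpos' := autFactor_pos hb'm hω1
    have e2 : diskAut b' (centeredMap φ b z) = φ (diskAut b z) := diskAut_diskAut hb'm hφσ
    rw [hgn _ hω, e2, ← e2, autFactor_diskAut hb hz, autFactor_diskAut hb'm hω,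
      ← ENNReal.ofReal_mul (by positivity), ← ENNReal.ofReal_mul (by positivity), e2]
    congr 1
    rw [Real.mul_rpow (by positivity) (norm_nonneg _), ← Real.rpow_mul (by positivity), hsp,
      inv_div_inv, Real.div_rpow hpos'.le hpos.le]
    field_simp
  have e3 : ∀ z ∈ unitDisk, ENNReal.ofReal (‖f (diskAut b' z)‖ ^ p) *
      ENNReal.ofReal (autFactor b' z ^ (2 + α) * (1 - ‖z‖ ^ 2) ^ α) =
      ENNReal.ofReal (‖g z‖ ^ p) * ENNReal.ofReal ((1 - ‖z‖ ^ 2) ^ α) := by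
    intro z hz
    have hpos' := autFactor_pos hb'm (mem_ball_zero_iff.1 hz).le
    rw [hgn _ hz, ← ENNReal.ofReal_mul (by positivity), ← ENNReal.ofReal_mul (by positivity),
      mul_assoc]
  rw [setLIntegral_congr_fun hD e1, setLIntegral_congr_fun hD e3]
  exact lintegral_comp_le hp hg (differentiableOn_centeredMap hφ hd hb) (centeredMap_zero φ b)
    (mapsTo_centeredMap hφ hb) (W := fun x => ENNReal.ofReal ((1 - x ^ 2) ^ α)) (by fun_prop)
    fun _ => ENNReal.ofReal_ne_top

/-! ### Boundary behaviour of the self-map -/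

section Radial

variable {a : ℂ}

theorem norm_ofReal_mul_of_norm_one (ha : ‖a‖ = 1) {r : ℝ} (hr : 0 ≤ r) : ‖(r : ℂ) * a‖ = r := by
  rw [norm_mul, ha, mul_one, Complex.norm_real, Real.norm_of_nonneg hr]

theorem eventually_mem_Ioo_nhdsLT_one : ∀ᶠ r : ℝ in 𝓝[<] 1, r ∈ Ioo (0 : ℝ) 1 :=
  Ioo_mem_nhdsLT one_pos

theorem tendsto_radial_nhds (a : ℂ) : Tendsto (fun r : ℝ => (r : ℂ) * a) (𝓝[<] 1) (𝓝 a) := by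
  have h : Continuous fun r : ℝ => (r : ℂ) * a := by fun_prop
  have := h.tendsto 1
  simp only [Complex.ofReal_one, one_mul] at this
  exact this.mono_left nhdsWithin_le_nhds

theorem radial_mem (ha : ‖a‖ = 1) {r : ℝ} (hr : r ∈ Ioo (0 : ℝ) 1) : (r : ℂ) * a ∈ unitDisk := by
  rw [mem_ball_zero_iff, norm_ofReal_mul_of_norm_one ha hr.1.le]
  exact hr.2

theorem tendsto_radial (ha : ‖a‖ = 1) :
    Tendsto (fun r : ℝ => (r : ℂ) * a) (𝓝[<] 1) (𝓝[unitDisk] a) :=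
  tendsto_nhdsWithin_iff.2 ⟨tendsto_radial_nhds a,
    eventually_mem_Ioo_nhdsLT_one.mono fun _ hr => radial_mem ha hr⟩

theorem norm_radial_sub (ha : ‖a‖ = 1) {r : ℝ} (hr : r ∈ Ioo (0 : ℝ) 1) :
    ‖(r : ℂ) * a - a‖ = 1 - r := by
  have h : (r : ℂ) * a - a = ((r - 1 : ℝ) : ℂ) * a := by push_cast; ring
  rw [h, norm_mul, ha, mul_one, Complex.norm_real, Real.norm_of_nonpos (by linarith [hr.2])]
  ring

theorem HasAngularLimit.tendsto_radial {g : ℂ → ℂ} {l : ℂ} (ha : ‖a‖ = 1)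
    (h : HasAngularLimit g a l) : Tendsto (fun r : ℝ => g ((r : ℂ) * a)) (𝓝[<] 1) (𝓝 l) := by
  refine (h 2 one_lt_two).comp (tendsto_nhdsWithin_iff.2 ⟨tendsto_radial_nhds a, ?_⟩)
  filter_upwards [eventually_mem_Ioo_nhdsLT_one] with r hr
  rw [norm_radial_sub ha hr, norm_ofReal_mul_of_norm_one ha hr.1.le]
  linarith [hr.2]

theorem nhdsWithin_unitDisk_neBot (ha : ‖a‖ = 1) : (𝓝[unitDisk] a).NeBot :=
  (tendsto_radial ha).neBot

theorem tendsto_one_sub_norm_sq (ha : ‖a‖ = 1) :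
    Tendsto (fun z : ℂ => 1 - ‖z‖ ^ 2) (𝓝 a) (𝓝 0) := by
  have h : Continuous fun z : ℂ => 1 - ‖z‖ ^ 2 := by fun_prop
  have := h.tendsto a
  rwa [ha, one_pow, sub_self] at this

theorem norm_one_sub_conj_mul (ha : ‖a‖ = 1) (z : ℂ) :
    ‖1 - (starRingEnd ℂ) a * z‖ = ‖z - a‖ := by
  have h := norm_sq_one_sub_conj_mul a z
  rw [ha] at h
  rw [← abs_of_nonneg (norm_nonneg (1 - _)), ← abs_of_nonneg (norm_nonneg (z - a)),
    ← sq_eq_sq_iff_abs_eq_abs, norm_sub_rev z a]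
  linarith

end Radial

/-- The data of an analytic self-map of the disc that is differentiable at the boundary fixed
point `a`, with derivative `c`, for unrestricted approach from within the disc. -/
structure HasBoundaryDeriv (φ : ℂ → ℂ) (a c : ℂ) : Prop where
  mapsTo : MapsTo φ unitDisk unitDisk
  diff : DifferentiableOn ℂ φ unitDisk
  norm_a : ‖a‖ = 1
  quot : Tendsto (fun z => (φ z - a) / (z - a)) (𝓝[unitDisk] a) (𝓝 c)

/-- If `a` is a boundary fixed point of `φ` and `φ'` extends continuously to `a`, with value `φ' a`,
then the difference quotient converges to `φ' a` for unrestricted approach. -/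
theorem hasBoundaryDeriv_of_tendsto_deriv {φ φ' : ℂ → ℂ} {a : ℂ} (hφ : MapsTo φ unitDisk unitDisk)
    (hφ' : ∀ z ∈ unitDisk, HasDerivAt φ (φ' z) z) (ha : ‖a‖ = 1) (hfix : HasAngularLimit φ a a)
    (hc : Tendsto φ' (𝓝[unitDisk] a) (𝓝 (φ' a))) : HasBoundaryDeriv φ a (φ' a) where
  mapsTo := hφ
  diff := fun z hz => (hφ' z hz).differentiableAt.differentiableWithinAt
  norm_a := ha
  quot := by
    rw [Metric.tendsto_nhds]
    intro ε hε
    have h1 := (Metric.tendsto_nhds.1 hc) (ε / 2) (by positivity)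
    obtain ⟨δ, hδ, hball⟩ := Metric.mem_nhdsWithin_iff.1 h1
    have key : ∀ z ∈ Metric.ball a δ ∩ unitDisk,
        ‖φ z - φ' a * z - (a - φ' a * a)‖ ≤ ε / 2 * ‖z - a‖ := by
      intro z hz
      have hconv : Convex ℝ (Metric.ball a δ ∩ unitDisk) :=
        (convex_ball a δ).inter (convex_ball 0 1)
      -- The mean value inequality for `φ z - φ' a * z` on the convex set near `a`, with one end
      -- of the segment tending to `a` along the radius.
      have h2 : ∀ᶠ r : ℝ in 𝓝[<] 1,
          ‖(φ z - φ' a * z) - (φ ((r : ℂ) * a) - φ' a * ((r : ℂ) * a))‖ ≤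
            ε / 2 * ‖z - (r : ℂ) * a‖ := by
        filter_upwards [(tendsto_radial ha).eventually
          (inter_mem (mem_nhdsWithin_of_mem_nhds (Metric.ball_mem_nhds a hδ))
            self_mem_nhdsWithin)] with r hr
        refine hconv.norm_image_sub_le_of_norm_hasDerivWithin_le
          (f := fun z => φ z - φ' a * z) (f' := fun z => φ' z - φ' a * 1)
          (fun x hx => (((hφ' x hx.2).sub ((hasDerivAt_id x).const_mul (φ' a)))).hasDerivWithinAt)
          (fun x hx => ?_) hr hz
        have := hball hx
        rw [Set.mem_ofPred_eq, dist_eq_norm] at this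
        rw [mul_one]
        exact this.le
      have h3 := hfix.tendsto_radial ha
      have h4 := tendsto_radial_nhds a
      exact le_of_tendsto_of_tendsto
        ((tendsto_const_nhds.sub (h3.sub (h4.const_mul (φ' a)))).norm)
        ((tendsto_const_nhds.sub h4).norm.const_mul _) h2
    filter_upwards [inter_mem (mem_nhdsWithin_of_mem_nhds (Metric.ball_mem_nhds a hδ))
      self_mem_nhdsWithin] with z hz
    have hne : z - a ≠ 0 := by
      intro h
      rw [sub_eq_zero] at h
      have := mem_ball_zero_iff.1 hz.2
      rw [h, ha] at this
      exact lt_irrefl _ this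
    have h5 := key z hz
    have h6 : (φ z - a) / (z - a) - φ' a = (φ z - φ' a * z - (a - φ' a * a)) / (z - a) := by
      field_simp
      ring
    rw [dist_eq_norm, h6, norm_div]
    have h7 := norm_pos_iff.2 hne
    calc _ ≤ ε / 2 * ‖z - a‖ / ‖z - a‖ := by gcongr
      _ = ε / 2 := by field_simp
      _ < ε := by linarith

namespace HasBoundaryDeriv

variable {φ : ℂ → ℂ} {a c : ℂ}

theorem sub_ne_zero (h : HasBoundaryDeriv φ a c) {z : ℂ} (hz : z ∈ unitDisk) : z - a ≠ 0 := by
  intro h0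
  rw [_root_.sub_eq_zero] at h0
  have := mem_ball_zero_iff.1 hz
  rw [h0, h.norm_a] at this
  exact lt_irrefl _ this

theorem tendsto_self (h : HasBoundaryDeriv φ a c) : Tendsto φ (𝓝[unitDisk] a) (𝓝 a) := by
  have h1 : Tendsto (fun z => (φ z - a) / (z - a) * (z - a) + a) (𝓝[unitDisk] a)
      (𝓝 (c * (a - a) + a)) :=
    (h.quot.mul ((tendsto_id.mono_left nhdsWithin_le_nhds).sub_const a)).add_const a
  rw [sub_self, mul_zero, zero_add] at h1
  refine h1.congr' ?_
  filter_upwards [self_mem_nhdsWithin] with z hz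
  rw [div_mul_cancel₀ _ (h.sub_ne_zero hz)]
  ring

/-- Along the radius to `a`, the quotient `(1 - |φ|²) / (1 - |z|²)` tends to `Re c`. -/
theorem tendsto_radial_quotient (h : HasBoundaryDeriv φ a c) :
    Tendsto (fun r : ℝ => (1 - ‖φ ((r : ℂ) * a)‖ ^ 2) / (1 - ‖(r : ℂ) * a‖ ^ 2)) (𝓝[<] 1)
      (𝓝 c.re) := by
  set Q : ℝ → ℂ := fun r => (φ ((r : ℂ) * a) - a) / ((r : ℂ) * a - a) with hQ
  have hQl : Tendsto Q (𝓝[<] 1) (𝓝 c) := h.quot.comp (tendsto_radial h.norm_a)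
  have hrl : Tendsto (fun r : ℝ => r) (𝓝[<] 1) (𝓝 1) := tendsto_id.mono_left nhdsWithin_le_nhds
  have h1 : Tendsto (fun r : ℝ => (2 * (Q r).re - (1 - r) * ‖Q r‖ ^ 2) / (1 + r)) (𝓝[<] 1)
      (𝓝 ((2 * c.re - (1 - 1) * ‖c‖ ^ 2) / (1 + 1))) :=
    ((((Complex.continuous_re.tendsto c).comp hQl).const_mul 2).sub
      ((hrl.const_sub 1).mul (hQl.norm.pow 2))).div (hrl.const_add 1) (by norm_num)
  have e : (2 * c.re - (1 - 1) * ‖c‖ ^ 2) / (1 + 1) = c.re := by ring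
  rw [e] at h1
  refine h1.congr' ?_
  filter_upwards [eventually_mem_Ioo_nhdsLT_one] with r hr
  have hne := h.sub_ne_zero (radial_mem h.norm_a hr)
  -- Expand `|φ(ra)|²` to second order in `1 - r`.
  have h2 : φ ((r : ℂ) * a) = a * (1 - ((1 - r : ℝ) : ℂ) * Q r) := by
    have : φ ((r : ℂ) * a) = Q r * ((r : ℂ) * a - a) + a := by
      simp only [hQ]
      rw [div_mul_cancel₀ _ hne]
      ring
    rw [this]
    push_cast
    ring
  have h3 : ‖φ ((r : ℂ) * a)‖ ^ 2 = 1 - 2 * (1 - r) * (Q r).re + (1 - r) ^ 2 * ‖Q r‖ ^ 2 := by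
    rw [h2, norm_mul, h.norm_a, one_mul, ← Complex.normSq_eq_norm_sq,
      ← Complex.normSq_eq_norm_sq, Complex.normSq_apply, Complex.normSq_apply]
    simp only [Complex.sub_re, Complex.sub_im, Complex.one_re, Complex.one_im,
      Complex.re_ofReal_mul, Complex.im_ofReal_mul]
    ring
  rw [h3, norm_ofReal_mul_of_norm_one h.norm_a hr.1.le]
  have h4 : 1 - r ≠ 0 := by linarith [hr.2]
  have h5 : 1 + r ≠ 0 := by linarith [hr.1]
  have h6 : 1 - r ^ 2 = (1 - r) * (1 + r) := by ring
  rw [h6]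
  field_simp
  ring

/-- By the Schwarz–Pick inequality at the origin, `(1 - |φ|²) / (1 - |z|²)` is bounded below, and so
is its radial limit. -/
theorem re_pos (h : HasBoundaryDeriv φ a c) : 0 < c.re := by
  have h0 : (0 : ℂ) ∈ unitDisk := by simp
  have hφ0 := mem_ball_zero_iff.1 (h.mapsTo h0)
  set m : ℝ := (1 - ‖φ 0‖) ^ 2 / (1 - ‖φ 0‖ ^ 2) with hm
  have h7 := one_sub_sq_pos (h.mapsTo h0)
  have hm1 : 0 < 1 - ‖φ 0‖ := by linarith
  have hm0 : 0 < m := by positivity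
  refine hm0.trans_le (ge_of_tendsto h.tendsto_radial_quotient ?_)
  filter_upwards [eventually_mem_Ioo_nhdsLT_one] with r hr
  have hz := radial_mem h.norm_a hr
  set z := (r : ℂ) * a
  have h1 := schwarzPick h.mapsTo h.diff h0 hz
  have h2 := mem_ball_zero_iff.1 (h.mapsTo hz)
  have h6 := one_sub_sq_pos (h.mapsTo hz)
  rw [autFactor_zero, one_mul] at h1
  have h4 : autFactor (φ 0) (φ z) ≤ m⁻¹ := by
    refine (autFactor_le (h.mapsTo h0) h2.le).trans ?_
    rw [hm, inv_div]
    gcongr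
    nlinarith [norm_nonneg (φ 0)]
  rw [le_div_iff₀ (one_sub_sq_pos hz), ← le_inv_mul_iff₀ hm0]
  exact h1.trans (mul_le_mul_of_nonneg_right h4 h6.le)

/-- The limit, as the base point tends radially to `a`, of the factor in the Schwarz–Pick
inequality. -/
theorem tendsto_autFactor_div (h : HasBoundaryDeriv φ a c) {z : ℂ} (hz : z ∈ unitDisk) :
    Tendsto (fun r : ℝ => autFactor ((r : ℂ) * a) z / autFactor (φ ((r : ℂ) * a)) (φ z))
      (𝓝[<] 1) (𝓝 (‖(φ z - a) / (z - a)‖ ^ 2 / c.re)) := by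
  have h1 := h.tendsto_radial_quotient.inv₀ h.re_pos.ne'
  have h2 := tendsto_radial_nhds a
  have h3 : Tendsto (fun r : ℝ => φ ((r : ℂ) * a)) (𝓝[<] 1) (𝓝 a) :=
    h.tendsto_self.comp (tendsto_radial h.norm_a)
  have hK : ∀ w : ℂ, Continuous fun b : ℂ => ‖1 - (starRingEnd ℂ) b * w‖ ^ 2 := by
    intro w
    have := Complex.continuous_conj
    fun_prop
  have h4 := ((hK (φ z)).tendsto a).comp h3
  have h5 := ((hK z).tendsto a).comp h2
  rw [norm_one_sub_conj_mul h.norm_a] at h4 h5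
  have hne := norm_pos_iff.2 (h.sub_ne_zero hz)
  have h6 := h1.mul (h4.div h5 (by positivity))
  have e : c.re⁻¹ * (‖φ z - a‖ ^ 2 / ‖z - a‖ ^ 2) = ‖(φ z - a) / (z - a)‖ ^ 2 / c.re := by
    rw [norm_div, div_pow]
    ring
  rw [e] at h6
  refine h6.congr' ?_
  filter_upwards [eventually_mem_Ioo_nhdsLT_one] with r hr
  have hb := radial_mem h.norm_a hr
  have g1 := one_sub_sq_pos hb
  have g2 := one_sub_sq_pos (h.mapsTo hb)
  have g3 := norm_pos_iff.2 (one_sub_conj_mul_ne_zero hb (mem_ball_zero_iff.1 hz).le)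
  have g4 := norm_pos_iff.2 (one_sub_conj_mul_ne_zero (h.mapsTo hb)
    (mem_ball_zero_iff.1 (h.mapsTo hz)).le)
  simp only [autFactor, Function.comp_apply, Pi.div_apply]
  field_simp

/-- **Julia's inequality** at the boundary fixed point: the Schwarz–Pick inequality for the points
`z` and `r * a`, in the limit `r → 1`. -/
theorem julia (h : HasBoundaryDeriv φ a c) {z : ℂ} (hz : z ∈ unitDisk) :
    ‖(φ z - a) / (z - a)‖ ^ 2 / c.re ≤ (1 - ‖φ z‖ ^ 2) / (1 - ‖z‖ ^ 2) := by
  refine le_of_tendsto (h.tendsto_autFactor_div hz) ?_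
  filter_upwards [eventually_mem_Ioo_nhdsLT_one] with r hr
  have hb := radial_mem h.norm_a hr
  have h1 := schwarzPick h.mapsTo h.diff hb hz
  have h2 := autFactor_pos (h.mapsTo hb) (mem_ball_zero_iff.1 (h.mapsTo hz)).le
  rw [div_le_div_iff₀ h2 (one_sub_sq_pos hz)]
  linarith

/-- Julia's inequality on the radius reads `|c|² ≤ (Re c)²`, so the boundary derivative is real. -/
theorem im_eq_zero (h : HasBoundaryDeriv φ a c) : c.im = 0 := by
  have h1 : ‖c‖ ^ 2 / c.re ≤ c.re := by
    refine le_of_tendsto_of_tendsto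
      (((h.quot.comp (tendsto_radial h.norm_a)).norm.pow 2).div_const c.re)
      h.tendsto_radial_quotient ?_
    filter_upwards [eventually_mem_Ioo_nhdsLT_one] with r hr
    exact h.julia (radial_mem h.norm_a hr)
  rw [div_le_iff₀ h.re_pos, ← Complex.normSq_eq_norm_sq, Complex.normSq_apply] at h1
  nlinarith [sq_nonneg c.im]

/-- The lower bound in Julia's inequality tends to the boundary derivative. -/
theorem tendsto_julia (h : HasBoundaryDeriv φ a c) :
    Tendsto (fun z => ‖(φ z - a) / (z - a)‖ ^ 2 / c.re) (𝓝[unitDisk] a) (𝓝 c.re) := by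
  have h1 := (h.quot.norm.pow 2).div_const c.re
  have h2 : ‖c‖ ^ 2 / c.re = c.re := by
    rw [← Complex.normSq_eq_norm_sq, Complex.normSq_apply, h.im_eq_zero]
    have := h.re_pos
    field_simp
    ring
  rwa [h2] at h1

end HasBoundaryDeriv

namespace HasBoundaryDeriv

variable {φ ψ : ℂ → ℂ} {a c : ℂ} {s : ℝ}

/-- The lower bound in Julia's inequality is positive: `φ` does not take the value `a` in the disc. -/
theorem julia_pos (h : HasBoundaryDeriv φ a c) {z : ℂ} (hz : z ∈ unitDisk) :
    0 < ‖(φ z - a) / (z - a)‖ ^ 2 / c.re := by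
  have h1 := norm_pos_iff.2 (h.sub_ne_zero hz)
  have h2 := norm_pos_iff.2 (h.sub_ne_zero (h.mapsTo hz))
  have h3 := h.re_pos
  rw [norm_div]
  positivity

theorem weightQuotient_eq (h : HasBoundaryDeriv φ a c) (ψ : ℂ → ℂ) (s : ℝ) {z : ℂ}
    (hz : z ∈ unitDisk) :
    weightQuotient φ ψ s z = ‖ψ z‖ / ((1 - ‖φ z‖ ^ 2) / (1 - ‖z‖ ^ 2)) ^ s := by
  have h1 := one_sub_sq_pos hz
  have h2 := one_sub_sq_pos (h.mapsTo hz)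
  rw [weightQuotient, Real.div_rpow h2.le h1.le, div_div_eq_mul_div]

/-- The weight quotient converges along the radius. -/
theorem tendsto_weightQuotient_radial (h : HasBoundaryDeriv φ a c)
    (hψ : Tendsto ψ (𝓝[unitDisk] a) (𝓝 (ψ a))) :
    Tendsto (fun r : ℝ => weightQuotient φ ψ s ((r : ℂ) * a)) (𝓝[<] 1)
      (𝓝 (‖ψ a‖ / c.re ^ s)) := by
  have h1 := (hψ.comp (tendsto_radial h.norm_a)).norm.div
    (h.tendsto_radial_quotient.rpow_const (p := s) (Or.inl h.re_pos.ne'))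
    (Real.rpow_pos_of_pos h.re_pos s).ne'
  refine h1.congr' ?_
  filter_upwards [eventually_mem_Ioo_nhdsLT_one] with r hr
  exact (h.weightQuotient_eq ψ s (radial_mem h.norm_a hr)).symm

/-- Julia's inequality bounds the upper limit from above, the radial limit bounds it from below. -/
theorem limsup_weightQuotient (h : HasBoundaryDeriv φ a c) (hs : 0 < s)
    (hψ : Tendsto ψ (𝓝[unitDisk] a) (𝓝 (ψ a))) :
    limsup (fun z => (weightQuotient φ ψ s z : EReal)) (𝓝[unitDisk] a) =
      ((‖ψ a‖ / c.re ^ s : ℝ) : EReal) := by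
  have := nhdsWithin_unitDisk_neBot h.norm_a
  apply le_antisymm
  · have h1 : Tendsto (fun z => ((‖ψ z‖ / (‖(φ z - a) / (z - a)‖ ^ 2 / c.re) ^ s : ℝ) : EReal))
        (𝓝[unitDisk] a) (𝓝 ((‖ψ a‖ / c.re ^ s : ℝ) : EReal)) :=
      (continuous_coe_real_ereal.tendsto _).comp
        (hψ.norm.div (h.tendsto_julia.rpow_const (Or.inl h.re_pos.ne'))
          (Real.rpow_pos_of_pos h.re_pos s).ne')
    rw [← h1.limsup_eq]
    refine limsup_le_limsup ?_
    filter_upwards [self_mem_nhdsWithin] with z hz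
    rw [h.weightQuotient_eq ψ s hz, EReal.coe_le_coe_iff]
    have h2 := Real.rpow_le_rpow (h.julia_pos hz).le (h.julia hz) hs.le
    have h3 := Real.rpow_pos_of_pos (h.julia_pos hz) s
    gcongr
  · have h1 : Tendsto (fun r : ℝ => (weightQuotient φ ψ s ((r : ℂ) * a) : EReal)) (𝓝[<] 1)
        (𝓝 ((‖ψ a‖ / c.re ^ s : ℝ) : EReal)) :=
      (continuous_coe_real_ereal.tendsto _).comp (h.tendsto_weightQuotient_radial hψ)
    rw [← h1.limsup_eq]
    exact limsup_le_limsup_of_le (u := fun z => (weightQuotient φ ψ s z : EReal))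
      (f := map (fun r : ℝ => (r : ℂ) * a) (𝓝[<] 1))
      (tendsto_radial h.norm_a)

end HasBoundaryDeriv

/-- If `a` is the only boundary point at which `|φ|` has upper limit `1`, then `φ` maps the part
of the disc away from `a` into a smaller disc. -/
theorem exists_norm_le_of_limsup {φ : ℂ → ℂ} {a : ℂ} (hφ : MapsTo φ unitDisk unitDisk)
    (hd : DifferentiableOn ℂ φ unitDisk)
    (hlim : ∀ w : ℂ, ‖w‖ = 1 → (limsup (fun z => ‖φ z‖) (𝓝[unitDisk] w) = 1 ↔ w = a))
    {δ : ℝ} (hδ : 0 < δ) : ∃ r < 1, ∀ z ∈ unitDisk, δ ≤ ‖z - a‖ → ‖φ z‖ ≤ r := by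
  have hK : IsCompact (Metric.closedBall (0 : ℂ) 1 \ Metric.ball a δ) :=
    (isCompact_closedBall 0 1).diff Metric.isOpen_ball
  have key : ∃ r < (1 : ℝ), ∀ z ∈ (Metric.closedBall (0 : ℂ) 1 \ Metric.ball a δ) ∩ unitDisk,
      ‖φ z‖ ≤ r := by
    refine hK.induction_on (p := fun t => ∃ r < (1 : ℝ), ∀ z ∈ t ∩ unitDisk, ‖φ z‖ ≤ r)
      ⟨0, one_pos, by simp⟩ ?_ ?_ ?_
    · rintro s t hst ⟨r, hr, h⟩
      exact ⟨r, hr, fun z hz => h z ⟨hst hz.1, hz.2⟩⟩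
    · rintro s t ⟨r, hr, h⟩ ⟨r', hr', h'⟩
      refine ⟨max r r', max_lt hr hr', ?_⟩
      rintro z ⟨hz | hz, hzD⟩
      · exact (h z ⟨hz, hzD⟩).trans (le_max_left _ _)
      · exact (h' z ⟨hz, hzD⟩).trans (le_max_right _ _)
    · rintro w ⟨hw1, hw2⟩
      have hlt : ∃ r < (1 : ℝ), ∀ᶠ z in 𝓝[unitDisk] w, ‖φ z‖ ≤ r := by
        rcases (mem_closedBall_zero_iff.1 hw1).lt_or_eq with hw | hw
        · have hwD : w ∈ unitDisk := mem_ball_zero_iff.2 hw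
          obtain ⟨r, h1, h2⟩ := exists_between (mem_ball_zero_iff.1 (hφ hwD))
          refine ⟨r, h2, ?_⟩
          filter_upwards [(hd.continuousOn.norm w hwD).eventually (gt_mem_nhds h1)] with z hz
          exact hz.le
        · have := nhdsWithin_unitDisk_neBot hw
          have hev : ∀ᶠ z in 𝓝[unitDisk] w, ‖φ z‖ ≤ 1 := by
            filter_upwards [self_mem_nhdsWithin] with z hz
            exact (mem_ball_zero_iff.1 (hφ hz)).le
          have hbd : IsBoundedUnder (· ≤ ·) (𝓝[unitDisk] w) fun z => ‖φ z‖ := ⟨1, by simpa using hev⟩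
          have hco : IsCoboundedUnder (· ≤ ·) (𝓝[unitDisk] w) fun z => ‖φ z‖ :=
            IsBoundedUnder.isCoboundedUnder_le ⟨0, by simp⟩
          have hle : limsup (fun z => ‖φ z‖) (𝓝[unitDisk] w) ≤ 1 := limsup_le_of_le hco hev
          have hne : limsup (fun z => ‖φ z‖) (𝓝[unitDisk] w) ≠ 1 := by
            intro h
            rw [hlim w hw] at h
            rw [h] at hw2
            exact hw2 (Metric.mem_ball_self hδ)
          obtain ⟨r, h1, h2⟩ := exists_between (lt_of_le_of_ne hle hne)
          exact ⟨r, h2, (eventually_lt_of_limsup_lt h1 hbd).mono fun z hz => hz.le⟩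
      obtain ⟨r, hr, hev⟩ := hlt
      obtain ⟨t, ht, hts⟩ := mem_nhdsWithin_iff_exists_mem_nhds_inter.1 hev
      exact ⟨t, mem_nhdsWithin_of_mem_nhds ht, r, hr, fun z hz => hts hz⟩
  obtain ⟨r, hr, h⟩ := key
  refine ⟨r, hr, fun z hz hza => h z ⟨⟨Metric.ball_subset_closedBall hz, ?_⟩, hz⟩⟩
  rw [Metric.mem_ball, dist_eq_norm]
  exact not_lt.2 hza

/-- The filters of `|φ(z)| → 1` and of `z → a` within the disc coincide. -/
theorem HasBoundaryDeriv.comap_norm_eq {φ : ℂ → ℂ} {a c : ℂ} (h : HasBoundaryDeriv φ a c)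
    (haway : ∀ δ : ℝ, 0 < δ → ∃ r < 1, ∀ z ∈ unitDisk, δ ≤ ‖z - a‖ → ‖φ z‖ ≤ r) :
    comap (fun z => ‖φ z‖) (𝓝 1) ⊓ 𝓟 unitDisk = 𝓝[unitDisk] a := by
  apply le_antisymm
  · refine le_inf ?_ inf_le_right
    rw [(Metric.nhds_basis_ball (x := a)).ge_iff]
    intro δ hδ
    obtain ⟨r, hr, hle⟩ := haway δ hδ
    have h1 : {z | r < ‖φ z‖} ∈ comap (fun z => ‖φ z‖) (𝓝 1) :=
      preimage_mem_comap (Ioi_mem_nhds hr)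
    filter_upwards [inter_mem_inf h1 (mem_principal_self unitDisk)] with z hz
    rw [Metric.mem_ball, dist_eq_norm]
    by_contra hcon
    exact absurd (hle z hz.2 (not_lt.1 hcon)) (not_le.2 hz.1)
  · refine le_inf ?_ inf_le_right
    rw [← tendsto_iff_comap]
    have := h.tendsto_self.norm
    rwa [h.norm_a] at this

/-! ### Montel's theorem on the disc -/

/-- **Montel's theorem** for the unit disc. The Taylor coefficients range in a product of compact
discs; along a subsequence they all converge, and then so do the functions. -/
theorem exists_subseq_tendstoUniformlyOn {F : ℕ → ℂ → ℂ}
    (hF : ∀ n, DifferentiableOn ℂ (F n) unitDisk)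
    (hb : ∀ r < (1 : ℝ), ∃ M, ∀ n, ∀ z : ℂ, ‖z‖ ≤ r → ‖F n z‖ ≤ M) :
    ∃ G : ℂ → ℂ, DifferentiableOn ℂ G unitDisk ∧ ∃ σ : ℕ → ℕ, StrictMono σ ∧
      ∀ r < (1 : ℝ), TendstoUniformlyOn (fun n => F (σ n)) G atTop (Metric.closedBall 0 r) := by
  choose! M hM using hb
  let A : ℕ → ℕ → ℂ := fun n k => (k.factorial : ℂ)⁻¹ * iteratedDeriv k (F n) 0
  have hA : ∀ n k, ∀ R ∈ Ioo (0 : ℝ) 1, ‖A n k‖ ≤ M R / R ^ k := by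
    intro n k R hR
    have h1 := Complex.norm_iteratedDeriv_le_of_forall_mem_sphere_norm_le k hR.1
      ((hF n).diffContOnCl_ball (Metric.closedBall_subset_ball hR.2))
      (fun z hz => hM R hR.2 n z (mem_sphere_zero_iff_norm.1 hz).le)
    have h2 : (0 : ℝ) < k.factorial := by exact_mod_cast k.factorial_pos
    simp only [A, norm_mul, norm_inv, Complex.norm_natCast]
    calc _ ≤ (k.factorial : ℝ)⁻¹ * (k.factorial * M R / R ^ k) := by gcongr
      _ = M R / R ^ k := by field_simp
  have hcomp : IsCompact (univ.pi fun k : ℕ =>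
      Metric.closedBall (0 : ℂ) (M (1 / 2) / (1 / 2) ^ k)) :=
    isCompact_univ_pi fun k => isCompact_closedBall _ _
  obtain ⟨B, -, σ, hσ, hlim⟩ := hcomp.isSeqCompact (x := A) fun n k _ =>
    mem_closedBall_zero_iff.2 (hA n k _ ⟨by norm_num, by norm_num⟩)
  have hlimk : ∀ k, Tendsto (fun n => A (σ n) k) atTop (𝓝 (B k)) := fun k =>
    (tendsto_pi_nhds.1 hlim) k
  have hB : ∀ k, ∀ R ∈ Ioo (0 : ℝ) 1, ‖B k‖ ≤ M R / R ^ k := fun k R hR =>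
    le_of_tendsto (hlimk k).norm (Eventually.of_forall fun n => hA _ k R hR)
  let G : ℂ → ℂ := fun z => ∑' k, B k * z ^ k
  have hFs : ∀ n, ∀ z ∈ unitDisk, HasSum (fun k => A n k * z ^ k) (F n z) := by
    intro n z hz
    have h := Complex.hasSum_taylorSeries_on_ball (hF n) hz
    refine h.congr_fun fun k => ?_
    simp only [A, sub_zero, smul_eq_mul]
    ring
  have hunif : ∀ r < (1 : ℝ),
      TendstoUniformlyOn (fun n => F (σ n)) G atTop (Metric.closedBall 0 r) := by
    intro r hr
    rcases lt_or_ge r 0 with hr0 | hr0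
    · rw [Metric.closedBall_eq_empty.2 hr0]
      exact tendstoUniformlyOn_empty
    obtain ⟨R, hrR, hR1⟩ := exists_between hr
    have hR : R ∈ Ioo (0 : ℝ) 1 := ⟨hr0.trans_lt hrR, hR1⟩
    have hq : Summable fun k : ℕ => (r / R) ^ k :=
      summable_geometric_of_lt_one (by have := hR.1; positivity) ((div_lt_one hR.1).2 hrR)
    have hterm : ∀ (C : ℂ) (k : ℕ), ‖C‖ ≤ M R / R ^ k → ‖C‖ * r ^ k ≤ M R * (r / R) ^ k := by
      intro C k hC
      have := mul_le_mul_of_nonneg_right hC (pow_nonneg hr0 k)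
      rw [div_pow]
      calc _ ≤ _ := this
        _ = _ := by ring
    -- On the disc of radius `r < R`, Cauchy's estimates on radius `R` dominate the series.
    have hdom : Tendsto (fun n => ∑' k, ‖A (σ n) k - B k‖ * r ^ k) atTop
        (𝓝 (∑' _ : ℕ, (0 : ℝ))) := by
      refine tendsto_tsum_of_dominated_convergence (bound := fun k => 2 * (M R * (r / R) ^ k))
        ((hq.mul_left _).mul_left _) (fun k => ?_) (Eventually.of_forall fun n k => ?_)
      · have := ((hlimk k).sub_const (B k)).norm.mul_const (r ^ k)
        simpa using this
      · have h1 := hterm _ k (hA (σ n) k R hR)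
        have h2 := hterm _ k (hB k R hR)
        have h3 := mul_le_mul_of_nonneg_right (norm_sub_le (A (σ n) k) (B k)) (pow_nonneg hr0 k)
        rw [Real.norm_of_nonneg (by positivity)]
        linarith
    rw [tsum_zero] at hdom
    rw [Metric.tendstoUniformlyOn_iff]
    intro ε hε
    filter_upwards [(tendsto_order.1 hdom).2 ε hε] with n hn z hz
    have hzr := mem_closedBall_zero_iff.1 hz
    have hzD : z ∈ unitDisk := mem_ball_zero_iff.2 (hzr.trans_lt hr)
    have hle : ∀ (C : ℂ) (k : ℕ), ‖C * z ^ k‖ ≤ ‖C‖ * r ^ k := by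
      intro C k
      rw [norm_mul, norm_pow]
      gcongr
    have sB : Summable fun k => B k * z ^ k :=
      Summable.of_norm_bounded (hq.mul_left (M R))
        fun k => (hle _ k).trans (hterm _ k (hB k R hR))
    have sD : Summable fun k => ‖A (σ n) k - B k‖ * r ^ k := by
      refine Summable.of_nonneg_of_le (fun k => by positivity) (fun k => ?_)
        ((hq.mul_left (M R)).mul_left 2)
      have h1 := hterm _ k (hA (σ n) k R hR)
      have h2 := hterm _ k (hB k R hR)
      have h3 := mul_le_mul_of_nonneg_right (norm_sub_le (A (σ n) k) (B k)) (pow_nonneg hr0 k)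
      linarith
    have hs := (hFs (σ n) z hzD).sub sB.hasSum
    have hs2 : HasSum (fun k => (A (σ n) k - B k) * z ^ k) (F (σ n) z - G z) := by
      simpa only [sub_mul] using hs
    rw [dist_comm, dist_eq_norm, ← hs2.tsum_eq]
    exact (tsum_of_norm_bounded sD.hasSum fun k => hle _ k).trans_lt hn
  refine ⟨G, ?_, σ, hσ, hunif⟩
  have hloc : TendstoLocallyUniformlyOn (fun n => F (σ n)) G atTop unitDisk := by
    rw [tendstoLocallyUniformlyOn_iff_forall_isCompact Metric.isOpen_ball]
    intro K hK hKc
    obtain ⟨r, hr, hKr⟩ := exists_lt_subset_ball hKc.isClosed hK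
    exact (hunif r hr).mono (hKr.trans Metric.ball_subset_closedBall)
  exact hloc.differentiableOn (Eventually.of_forall fun n => hF _) Metric.isOpen_ball

/-! ### Conformally weighted norms on the disc -/

/-- A functional `N` on functions on the disc with the properties of a norm of conformal weight
`s`: besides the lattice-norm axioms and Fatou's lemma, the sharp subordination inequality
`conformal`, which gives at once the boundedness of composition operators, the pointwise estimate
and the bound for the test functions. -/
structure IsConformalNorm (s : ℝ) (N : (unitDisk → ℂ) → ENNReal) : Prop where
  mono : ∀ g h : unitDisk → ℂ, (∀ z, ‖g z‖ ≤ ‖h z‖) → N g ≤ N h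
  add_le : ∀ g h : unitDisk → ℂ, Measurable g → Measurable h → N (g + h) ≤ N g + N h
  smul : ∀ (c : ℂ) (g : unitDisk → ℂ), N (c • g) = ‖c‖ₑ * N g
  one : N 1 = 1
  fatou : ∀ (g : ℕ → unitDisk → ℂ) (h : unitDisk → ℂ), (∀ n, Measurable (g n)) →
    (∀ z, Tendsto (fun n => g n z) atTop (𝓝 (h z))) → N h ≤ liminf (fun n => N (g n)) atTop
  conformal : ∀ (f φ : ℂ → ℂ) (b : ℂ), DifferentiableOn ℂ f unitDisk →
    MapsTo φ unitDisk unitDisk → DifferentiableOn ℂ φ unitDisk → b ∈ unitDisk →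
    N (fun z => (((autFactor b z / autFactor (φ b) (φ z)) ^ s * ‖f (φ z)‖ : ℝ) : ℂ)) ≤
      N (fun z => f z)

/-- The normed space `X` consists, through `ι`, of the analytic functions of finite `N`-norm. -/
structure IsAnalyticSpace {X : Type*} [NormedAddCommGroup X] [NormedSpace ℂ X]
    (N : (unitDisk → ℂ) → ENNReal) (ι : X →ₗ[ℂ] (unitDisk → ℂ)) : Prop where
  injective : Function.Injective ι
  analytic : ∀ f, AnalyticInDisk (ι f)
  enorm_eq : ∀ f, N (ι f) = ‖f‖ₑ
  exists_eq : ∀ g, AnalyticInDisk g → N g ≠ ⊤ → ∃ f, ι f = g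

namespace IsConformalNorm

variable {s : ℝ} {N : (unitDisk → ℂ) → ENNReal}

theorem le_add (hN : IsConformalNorm s N) {u g h : unitDisk → ℂ} {A B : ℝ} (hA : 0 ≤ A)
    (hB : 0 ≤ B) (hg : Measurable g) (hh : Measurable h)
    (hle : ∀ z, ‖u z‖ ≤ A * ‖g z‖ + B * ‖h z‖) :
    N u ≤ ENNReal.ofReal A * N g + ENNReal.ofReal B * N h := by
  have key : ∀ (C : ℝ) (k : unitDisk → ℂ), 0 ≤ C →
      N ((C : ℂ) • fun z => ((‖k z‖ : ℝ) : ℂ)) ≤ ENNReal.ofReal C * N k := by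
    intro C k hC
    rw [hN.smul, ← ofReal_norm, Complex.norm_real, Real.norm_of_nonneg hC]
    gcongr
    exact hN.mono _ _ fun z => by simp
  have hmeas : ∀ (C : ℝ) (k : unitDisk → ℂ), Measurable k →
      Measurable ((C : ℂ) • fun z => ((‖k z‖ : ℝ) : ℂ)) := fun C k hk =>
    (Complex.measurable_ofReal.comp hk.norm).const_smul (C : ℂ)
  refine le_trans (hN.mono u ((A : ℂ) • (fun z => ((‖g z‖ : ℝ) : ℂ)) +
    (B : ℂ) • fun z => ((‖h z‖ : ℝ) : ℂ)) fun z => ?_)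
    ((hN.add_le _ _ (hmeas A g hg) (hmeas B h hh)).trans (add_le_add (key A g hA) (key B h hB)))
  have e : ((A : ℂ) • (fun z => ((‖g z‖ : ℝ) : ℂ)) +
      (B : ℂ) • fun z => ((‖h z‖ : ℝ) : ℂ)) z = ((A * ‖g z‖ + B * ‖h z‖ : ℝ) : ℂ) := by
    simp
  rw [e, Complex.norm_real, Real.norm_of_nonneg (by positivity)]
  exact hle z

theorem le_mul (hN : IsConformalNorm s N) {u g : unitDisk → ℂ} {A : ℝ} (hA : 0 ≤ A)
    (hg : Measurable g) (hle : ∀ z, ‖u z‖ ≤ A * ‖g z‖) : N u ≤ ENNReal.ofReal A * N g := by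
  have h := hN.le_add (u := u) (h := g) hA le_rfl hg hg (by simpa using hle)
  simpa using h

theorem const (hN : IsConformalNorm s N) (c : ℂ) : N (fun _ => c) = ‖c‖ₑ := by
  have h := hN.smul c 1
  rw [hN.one, mul_one] at h
  rw [← h]
  congr 1
  funext z
  simp

/-- The pointwise estimate: the conformal inequality for a constant self-map. -/
theorem norm_mul_le (hN : IsConformalNorm s N) {f : ℂ → ℂ} (hf : DifferentiableOn ℂ f unitDisk)
    {w : ℂ} (hw : w ∈ unitDisk) :
    ENNReal.ofReal (‖f w‖ * (1 - ‖w‖ ^ 2) ^ s) ≤ N (fun z => f z) := by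
  have h := hN.conformal f (fun _ => w) 0 hf (fun _ _ => hw) (differentiableOn_const w) (by simp)
  simp only [autFactor_zero, autFactor_self hw, one_div, inv_inv] at h
  rw [hN.const] at h
  refine le_trans (le_of_eq ?_) h
  rw [← ofReal_norm, Complex.norm_real, Real.norm_of_nonneg, mul_comm]
  exact mul_nonneg (Real.rpow_nonneg (one_sub_sq_pos hw).le _) (norm_nonneg _)

theorem testKernel_le_one (hN : IsConformalNorm s N) {w : ℂ} (hw : w ∈ unitDisk) :
    N (fun z => testKernel s w z) ≤ 1 := by
  have h := hN.conformal (fun _ => 1) (fun _ => 0) w (differentiableOn_const 1)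
    (fun _ _ => by simp) (differentiableOn_const 0) hw
  simp only [autFactor_zero, div_one, norm_one, mul_one] at h
  rw [hN.const, enorm_one] at h
  refine (hN.mono _ _ fun z => ?_).trans h
  have hz := (mem_ball_zero_iff.1 z.2).le
  rw [norm_testKernel hw hz, Complex.norm_real, Real.norm_of_nonneg]
  exact Real.rpow_nonneg (autFactor_pos hw hz).le _

theorem measurable_comp {φ : ℂ → ℂ} (hφ : MapsTo φ unitDisk unitDisk)
    (hd : DifferentiableOn ℂ φ unitDisk) {f : ℂ → ℂ} (hf : DifferentiableOn ℂ f unitDisk) :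
    Measurable fun z : unitDisk => f (φ z) :=
  ((hf.continuousOn.comp hd.continuousOn hφ).comp_continuous continuous_subtype_val
    fun z => z.2).measurable

theorem measurable_autFactor (b : ℂ) : Measurable (autFactor b) := by
  have h : Continuous fun z : ℂ => ‖1 - (starRingEnd ℂ) b * z‖ ^ 2 := by fun_prop
  exact h.measurable.const_div _

theorem measurable_conformal {φ : ℂ → ℂ} (hφ : MapsTo φ unitDisk unitDisk)
    (hd : DifferentiableOn ℂ φ unitDisk) {f : ℂ → ℂ} (hf : DifferentiableOn ℂ f unitDisk)
    (s : ℝ) (b b' : ℂ) : Measurable fun z : unitDisk =>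
      (((autFactor b z / autFactor b' (φ z)) ^ s * ‖f (φ z)‖ : ℝ) : ℂ) :=
  Complex.measurable_ofReal.comp
    (((((measurable_autFactor b).comp measurable_subtype_coe).div
      ((measurable_autFactor b').comp
        (measurable_comp (f := id) hφ hd differentiableOn_id))).pow_const s).mul
      (measurable_comp hφ hd hf).norm)

/-- Composition with a self-map is bounded: the conformal inequality at the origin. -/
theorem exists_comp_le (hN : IsConformalNorm s N) (hs : 0 < s) {φ : ℂ → ℂ}
    (hφ : MapsTo φ unitDisk unitDisk) (hd : DifferentiableOn ℂ φ unitDisk) :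
    ∃ C : ℝ, 0 ≤ C ∧ ∀ f : ℂ → ℂ, DifferentiableOn ℂ f unitDisk →
      N (fun z => f (φ z)) ≤ ENNReal.ofReal C * N (fun z => f z) := by
  have h0 : (0 : ℂ) ∈ unitDisk := by simp
  have hφ0 := mem_ball_zero_iff.1 (hφ h0)
  have h7 := one_sub_sq_pos (hφ h0)
  have hm1 : 0 < 1 - ‖φ 0‖ := by linarith
  set m : ℝ := (1 - ‖φ 0‖) ^ 2 / (1 - ‖φ 0‖ ^ 2) with hm
  have hm0 : 0 < m := by positivity
  refine ⟨(m ^ s)⁻¹, by positivity, fun f hf => ?_⟩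
  refine (hN.le_mul (by positivity) (measurable_conformal hφ hd hf s 0 (φ 0)) fun z => ?_).trans
    (mul_le_mul_right (hN.conformal f φ 0 hf hφ hd h0) _)
  have hz := (mem_ball_zero_iff.1 (hφ z.2)).le
  have h3 := autFactor_pos (hφ h0) hz
  have h4 : m ≤ (autFactor (φ 0) (φ z))⁻¹ := by
    rw [le_inv_comm₀ hm0 h3]
    refine (autFactor_le (hφ h0) hz).trans ?_
    rw [hm, inv_div]
    gcongr
    nlinarith [norm_nonneg (φ 0)]
  rw [Complex.norm_real, Real.norm_of_nonneg (by rw [autFactor_zero]; positivity),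
    autFactor_zero, one_div]
  have h5 := Real.rpow_le_rpow hm0.le h4 hs.le
  have h6 : 0 < m ^ s := by positivity
  calc ‖f (φ z)‖ = (m ^ s)⁻¹ * (m ^ s * ‖f (φ z)‖) := by field_simp
    _ ≤ _ := by gcongr

/-- The conformal inequality normalised at the boundary fixed point, by Fatou's lemma. -/
theorem conformal_boundary (hN : IsConformalNorm s N) (hs : 0 < s) {φ : ℂ → ℂ} {a c : ℂ}
    (h : HasBoundaryDeriv φ a c) {f : ℂ → ℂ} (hf : DifferentiableOn ℂ f unitDisk) :
    N (fun z => (((‖(φ z - a) / (z - a)‖ ^ 2 / c.re) ^ s * ‖f (φ z)‖ : ℝ) : ℂ)) ≤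
      N (fun z => f z) := by
  obtain ⟨r, hr⟩ := (𝓝[<] (1 : ℝ)).exists_seq_tendsto
  have hmem := hr.eventually eventually_mem_Ioo_nhdsLT_one
  refine (hN.fatou (fun n z => (((autFactor ((r n : ℂ) * a) z /
    autFactor (φ ((r n : ℂ) * a)) (φ z)) ^ s * ‖f (φ z)‖ : ℝ) : ℂ)) _ (fun n => ?_)
    fun z => ?_).trans ?_
  · exact measurable_conformal h.mapsTo h.diff hf s _ _
  · refine (Complex.continuous_ofReal.tendsto _).comp ?_
    exact (((h.tendsto_autFactor_div z.2).comp hr).rpow_const (Or.inr hs.le)).mul_const _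
  · refine liminf_le_of_frequently_le' (hmem.mono fun n hn => ?_).frequently
    exact hN.conformal f φ _ hf h.mapsTo h.diff (radial_mem h.norm_a hn)

end IsConformalNorm

/-! ### Weighted composition operators: boundedness and compactness -/

/-- `T` is the weighted composition operator `f ↦ u * (f ∘ φ)` on a space of functions. -/
def IsWeightedComposition {X : Type*} [NormedAddCommGroup X] [NormedSpace ℂ X]
    (ι : X →ₗ[ℂ] (unitDisk → ℂ)) {φ : ℂ → ℂ} (hφ : MapsTo φ unitDisk unitDisk) (u : ℂ → ℂ)
    (T : X →L[ℂ] X) : Prop :=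
  ∀ f z, ι (T f) z = u z * ι f ⟨φ z, hφ z.2⟩

namespace IsAnalyticSpace

variable {s : ℝ} {N : (unitDisk → ℂ) → ENNReal} {X : Type*} [NormedAddCommGroup X]
  [NormedSpace ℂ X] {ι : X →ₗ[ℂ] (unitDisk → ℂ)} {φ : ℂ → ℂ} {hφ : MapsTo φ unitDisk unitDisk}

/-- An element of the space, as a function on `ℂ` that is differentiable on the disc. -/
theorem exists_extension (hX : IsAnalyticSpace N ι) (f : X) :
    ∃ F : ℂ → ℂ, DifferentiableOn ℂ F unitDisk ∧ (ι f = fun z : unitDisk => F z) ∧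
      N (fun z => F z) = ‖f‖ₑ := by
  obtain ⟨F, hF, h⟩ := hX.analytic f
  have e : ι f = fun z : unitDisk => F z := funext fun z => (h z).symm
  exact ⟨F, hF, e, by rw [← e, hX.enorm_eq]⟩

theorem norm_mul_le (hN : IsConformalNorm s N) (hX : IsAnalyticSpace N ι) (f : X)
    (z : unitDisk) : ‖ι f z‖ * (1 - ‖(z : ℂ)‖ ^ 2) ^ s ≤ ‖f‖ := by
  obtain ⟨F, hF, e, hNF⟩ := hX.exists_extension f
  have h := hN.norm_mul_le hF z.2
  rw [hNF, ← ofReal_norm, ENNReal.ofReal_le_ofReal_iff (norm_nonneg _)] at h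
  rwa [e]

/-- The test kernels, of norm at most one, belong to the space. -/
theorem exists_testKernel (hN : IsConformalNorm s N) (hX : IsAnalyticSpace N ι) {w : ℂ}
    (hw : w ∈ unitDisk) : ∃ k : X, ‖k‖ ≤ 1 ∧ ι k = fun z : unitDisk => testKernel s w z := by
  have h1 := hN.testKernel_le_one hw
  obtain ⟨k, hk⟩ := hX.exists_eq (fun z => testKernel s w z)
    ⟨testKernel s w, differentiableOn_testKernel hw s, fun _ => rfl⟩
    (ne_top_of_le_ne_top ENNReal.one_ne_top h1)
  refine ⟨k, ?_, hk⟩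
  rw [← hk, hX.enorm_eq, ← ofReal_norm, ENNReal.ofReal_le_one] at h1
  exact h1

/-- A bounded analytic weight defines a bounded weighted composition operator. -/
theorem exists_operator (hN : IsConformalNorm s N) (hX : IsAnalyticSpace N ι) (hs : 0 < s)
    (hφ : MapsTo φ unitDisk unitDisk) (hd : DifferentiableOn ℂ φ unitDisk) {u : ℂ → ℂ}
    (hu : DifferentiableOn ℂ u unitDisk) (hub : ∃ C : ℝ, ∀ z ∈ unitDisk, ‖u z‖ ≤ C) :
    ∃ T : X →L[ℂ] X, IsWeightedComposition ι hφ u T := by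
  obtain ⟨B, hB⟩ := hub
  have hB0 : 0 ≤ B := (norm_nonneg _).trans (hB 0 (by simp))
  obtain ⟨C, hC0, hC⟩ := hN.exists_comp_le hs hφ hd
  have key : ∀ f : X, ∃ g : X, (∀ z, ι g z = u z * ι f ⟨φ z, hφ z.2⟩) ∧ ‖g‖ ≤ B * C * ‖f‖ := by
    intro f
    obtain ⟨F, hF, e, hNF⟩ := hX.exists_extension f
    have hle : N (fun z => u z * F (φ z)) ≤ ENNReal.ofReal (B * C * ‖f‖) := by
      refine (hN.le_mul (g := fun z => F (φ z)) hB0 (IsConformalNorm.measurable_comp hφ hd hF)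
        fun z => ?_).trans ((mul_le_mul_right (hC F hF) _).trans (le_of_eq ?_))
      · rw [norm_mul]
        exact mul_le_mul_of_nonneg_right (hB z z.2) (norm_nonneg _)
      · rw [hNF, ← ofReal_norm, mul_assoc, ENNReal.ofReal_mul hB0, ENNReal.ofReal_mul hC0]
    obtain ⟨g, hg⟩ := hX.exists_eq (fun z => u z * F (φ z))
      ⟨fun z => u z * F (φ z), hu.mul (hF.comp hd hφ), fun _ => rfl⟩
      (ne_top_of_le_ne_top ENNReal.ofReal_ne_top hle)
    refine ⟨g, fun z => by rw [hg, e], ?_⟩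
    rw [← hg, hX.enorm_eq, ← ofReal_norm,
      ENNReal.ofReal_le_ofReal_iff (by positivity)] at hle
    exact hle
  choose T hT hTn using key
  let L : X →ₗ[ℂ] X :=
    { toFun := T
      map_add' := fun f g => hX.injective (funext fun z => by
        simp only [map_add, Pi.add_apply, hT]
        ring)
      map_smul' := fun c f => hX.injective (funext fun z => by
        simp only [map_smul, Pi.smul_apply, hT, smul_eq_mul, RingHom.id_apply]
        ring) }
  exact ⟨L.mkContinuous (B * C) hTn, fun f z => hT f z⟩

/-- A weighted composition operator is bounded by the size of its weight relative to Julia's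
factor near `a`, up to a small multiple of the norm of the composition operator. -/
theorem norm_operator_le (hN : IsConformalNorm s N) (hX : IsAnalyticSpace N ι) (hs : 0 < s)
    {a c : ℂ} (h : HasBoundaryDeriv φ a c) {C : ℝ} (hC0 : 0 ≤ C)
    (hC : ∀ f : ℂ → ℂ, DifferentiableOn ℂ f unitDisk →
      N (fun z => f (φ z)) ≤ ENNReal.ofReal C * N (fun z => f z))
    {u : ℂ → ℂ} {T : X →L[ℂ] X} (hT : IsWeightedComposition ι hφ u T) {A ε : ℝ} (hA : 0 ≤ A)
    (hε : 0 ≤ ε)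
    (hu : ∀ z ∈ unitDisk, ‖u z‖ ≤ A * (‖(φ z - a) / (z - a)‖ ^ 2 / c.re) ^ s + ε) :
    ‖T‖ ≤ A + ε * C := by
  refine T.opNorm_le_bound (by positivity) fun f => ?_
  obtain ⟨F, hF, e, hNF⟩ := hX.exists_extension f
  have hm := IsConformalNorm.measurable_comp h.mapsTo h.diff hF
  have hmφ := IsConformalNorm.measurable_comp (f := id) h.mapsTo h.diff differentiableOn_id
  simp only [id] at hmφ
  have h1 : N (ι (T f)) ≤ ENNReal.ofReal ((A + ε * C) * ‖f‖) := by
    refine (hN.le_add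
      (g := fun z => (((‖(φ z - a) / (z - a)‖ ^ 2 / c.re) ^ s * ‖F (φ z)‖ : ℝ) : ℂ))
      (h := fun z => F (φ z)) hA hε ?_ hm fun z => ?_).trans
      ((add_le_add (mul_le_mul_right (hN.conformal_boundary hs h hF) _)
        (mul_le_mul_right (hC F hF) _)).trans (le_of_eq ?_))
    · exact Complex.measurable_ofReal.comp ((((((hmφ.sub_const a).div
        (measurable_subtype_coe.sub_const a)).norm.pow_const 2).div_const _).pow_const s).mul
          hm.norm)
    · have h2 := mul_le_mul_of_nonneg_right (hu z z.2) (norm_nonneg (F (φ z)))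
      have h3 := h.julia_pos z.2
      rw [hT, e, norm_mul, Complex.norm_real, Real.norm_of_nonneg (by positivity)]
      linarith
    · rw [hNF, ← ofReal_norm, add_mul, ENNReal.ofReal_add (by positivity) (by positivity),
        ENNReal.ofReal_mul hA, mul_assoc, ENNReal.ofReal_mul hε, ENNReal.ofReal_mul hC0]
  rwa [hX.enorm_eq, ← ofReal_norm, ENNReal.ofReal_le_ofReal_iff (by positivity)] at h1

/-- A bounded sequence has a subsequence that converges locally uniformly to an element of the
space. -/
theorem exists_subseq (hN : IsConformalNorm s N) (hX : IsAnalyticSpace N ι) (hs : 0 < s)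
    {f : ℕ → X} (hf : ∀ n, ‖f n‖ ≤ 1) :
    ∃ g : X, ‖g‖ ≤ 1 ∧ ∃ σ : ℕ → ℕ, StrictMono σ ∧ ∀ r < (1 : ℝ), ∀ ε > 0, ∀ᶠ n in atTop,
      ∀ z : unitDisk, ‖(z : ℂ)‖ ≤ r → ‖ι (f (σ n) - g) z‖ ≤ ε := by
  choose F hF he hNF using fun n => hX.exists_extension (f n)
  have hbd : ∀ r < (1 : ℝ), ∃ M, ∀ n, ∀ z : ℂ, ‖z‖ ≤ r → ‖F n z‖ ≤ M := by
    intro r hr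
    refine ⟨((1 - r ^ 2) ^ s)⁻¹, fun n z hz => ?_⟩
    have hzD : z ∈ unitDisk := mem_ball_zero_iff.2 (hz.trans_lt hr)
    have h1 := hX.norm_mul_le hN (f n) ⟨z, hzD⟩
    have hr2 : 0 < 1 - r ^ 2 := by nlinarith [norm_nonneg z]
    have h2 : (1 - r ^ 2) ^ s ≤ (1 - ‖z‖ ^ 2) ^ s :=
      Real.rpow_le_rpow hr2.le (by nlinarith [norm_nonneg z]) hs.le
    have h3 : 0 < (1 - r ^ 2) ^ s := by positivity
    rw [he] at h1
    rw [← one_div, le_div_iff₀ h3]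
    exact (mul_le_mul_of_nonneg_left h2 (norm_nonneg _)).trans (h1.trans (hf n))
  obtain ⟨G, hG, σ, hσ, hunif⟩ := exists_subseq_tendstoUniformlyOn hF hbd
  have hpt : ∀ z : unitDisk, Tendsto (fun n => F (σ n) z) atTop (𝓝 (G z)) := fun z =>
    (hunif _ (mem_ball_zero_iff.1 z.2)).tendsto_at (mem_closedBall_zero_iff.2 le_rfl)
  have hNG : N (fun z => G z) ≤ 1 := by
    refine (hN.fatou (fun n z => F (σ n) z) _ (fun n => ?_) hpt).trans ?_
    · exact ((hF _).continuousOn.comp_continuous continuous_subtype_val fun z => z.2).measurable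
    · refine liminf_le_of_frequently_le' (Frequently.of_forall fun n => ?_)
      rw [hNF, ← ofReal_norm, ENNReal.ofReal_le_one]
      exact hf _
  obtain ⟨g, hg⟩ := hX.exists_eq (fun z => G z) ⟨G, hG, fun _ => rfl⟩
    (ne_top_of_le_ne_top ENNReal.one_ne_top hNG)
  refine ⟨g, ?_, σ, hσ, fun r hr ε hε => ?_⟩
  · rwa [← hg, hX.enorm_eq, ← ofReal_norm, ENNReal.ofReal_le_one] at hNG
  · filter_upwards [(Metric.tendstoUniformlyOn_iff.1 (hunif r hr)) ε hε] with n hn z hz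
    have h1 := (hn z (mem_closedBall_zero_iff.2 hz)).le
    rw [dist_comm, dist_eq_norm] at h1
    rwa [map_sub, Pi.sub_apply, he, hg]

/-- A weighted composition operator whose weight tends to zero at the only boundary point where
`|φ|` comes close to `1` is compact. -/
theorem isCompactOperator (hN : IsConformalNorm s N) (hX : IsAnalyticSpace N ι) (hs : 0 < s)
    {a : ℂ} (hd : DifferentiableOn ℂ φ unitDisk)
    (haway : ∀ δ : ℝ, 0 < δ → ∃ r < 1, ∀ z ∈ unitDisk, δ ≤ ‖z - a‖ → ‖φ z‖ ≤ r)
    {u : ℂ → ℂ} (hub : ∃ C : ℝ, ∀ z ∈ unitDisk, ‖u z‖ ≤ C)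
    (hu0 : Tendsto u (𝓝[unitDisk] a) (𝓝 0))
    {T : X →L[ℂ] X} (hT : IsWeightedComposition ι hφ u T) : IsCompactOperator T := by
  obtain ⟨B, hB⟩ := hub
  have hB0 : 0 ≤ B := (norm_nonneg _).trans (hB 0 (by simp))
  obtain ⟨C, hC0, hC⟩ := hN.exists_comp_le hs hφ hd
  rw [isCompactOperator_iff_exists_mem_nhds_image_subset_compact]
  refine ⟨Metric.closedBall 0 1, Metric.closedBall_mem_nhds 0 one_pos,
    T '' Metric.closedBall 0 1, IsSeqCompact.isCompact ?_, Subset.rfl⟩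
  intro y hy
  choose f hf hfy using hy
  obtain ⟨g, hg, σ, hσ, hconv⟩ := hX.exists_subseq hN hs
    (fun n => mem_closedBall_zero_iff.1 (hf n))
  refine ⟨T g, ⟨g, mem_closedBall_zero_iff.2 hg, rfl⟩, σ, hσ, ?_⟩
  have key : ∀ ε > (0 : ℝ), ∀ᶠ n in atTop, ‖T (f (σ n)) - T g‖ ≤ ε * (C * 2) + B * ε := by
    intro ε hε
    obtain ⟨δ, hδ, hball⟩ := Metric.mem_nhdsWithin_iff.1
      ((Metric.tendsto_nhds.1 hu0) ε hε)
    obtain ⟨r, hr, hφr⟩ := haway δ hδ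
    filter_upwards [hconv r hr ε hε] with n hn
    set q := f (σ n) - g with hq
    have hq2 : ‖q‖ ≤ 2 := by
      have h1 := norm_sub_le (f (σ n)) g
      have h2 := mem_closedBall_zero_iff.1 (hf (σ n))
      linarith
    obtain ⟨F, hF, e, hNF⟩ := hX.exists_extension q
    have h1 : N (ι (T q)) ≤ ENNReal.ofReal (ε * (C * 2) + B * ε) := by
      refine (hN.le_add (g := fun z => F (φ z)) (h := fun _ => ((ε : ℝ) : ℂ)) hε.le hB0
        (IsConformalNorm.measurable_comp hφ hd hF) measurable_const fun z => ?_).trans ?_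
      · rw [hT, e, norm_mul, Complex.norm_real, Real.norm_of_nonneg hε.le]
        -- Near `a` the weight is small; elsewhere `φ` stays in a compact set, where `F` is small.
        by_cases hz : ‖(z : ℂ) - a‖ < δ
        · have h2 := hball ⟨by rwa [Metric.mem_ball, dist_eq_norm], z.2⟩
          have h3 : ‖u z‖ ≤ ε := by
            have h4 : dist (u z) 0 < ε := h2
            rw [dist_zero_right] at h4
            exact h4.le
          have := mul_le_mul_of_nonneg_right h3 (norm_nonneg (F (φ z)))
          have : 0 ≤ B * ε := by positivity
          linarith
        · have h2 := hn ⟨φ z, hφ z.2⟩ (hφr z z.2 (not_lt.1 hz))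
          rw [e] at h2
          have h3 := mul_le_mul (hB z z.2) h2 (norm_nonneg _) hB0
          have : 0 ≤ ε * ‖F (φ z)‖ := by positivity
          linarith
      · have h2 : N (fun z => F (φ z)) ≤ ENNReal.ofReal (C * 2) := by
          refine (hC F hF).trans ?_
          rw [hNF, ← ofReal_norm, ENNReal.ofReal_mul hC0]
          gcongr
        rw [hN.const, ← ofReal_norm, Complex.norm_real, Real.norm_of_nonneg hε.le,
          ENNReal.ofReal_add (by positivity) (by positivity), ENNReal.ofReal_mul hε.le,
          ENNReal.ofReal_mul hB0]
        gcongr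
    rw [hX.enorm_eq, ← ofReal_norm, ENNReal.ofReal_le_ofReal_iff (by positivity)] at h1
    rwa [hq, map_sub] at h1
  rw [tendsto_iff_norm_sub_tendsto_zero]
  simp only [Function.comp_apply, ← hfy]
  rw [Metric.tendsto_nhds]
  intro η hη
  have hD : 0 < C * 2 + B + 1 := by positivity
  filter_upwards [key (η / (2 * (C * 2 + B + 1))) (by positivity)] with n hn
  rw [dist_zero_right, norm_norm]
  refine hn.trans_lt ?_
  have h1 : η / (2 * (C * 2 + B + 1)) * (C * 2) + B * (η / (2 * (C * 2 + B + 1))) =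
      η * ((C * 2 + B) / (2 * (C * 2 + B + 1))) := by ring
  rw [h1]
  have h2 : (C * 2 + B) / (2 * (C * 2 + B + 1)) < 1 := by
    rw [div_lt_one (by positivity)]
    linarith [mul_nonneg hC0 zero_le_two]
  nlinarith

end IsAnalyticSpace

/-! ### The upper estimate -/

/-- The function `(1 + conj a * z) / 2`, which peaks at the boundary point `a` of the disc. -/
noncomputable def peakFunction (a z : ℂ) : ℂ := (1 + (starRingEnd ℂ) a * z) / 2

/-- The parallelogram law for `1` and `conj a * z`. -/
theorem norm_peakFunction_sq {a : ℂ} (ha : ‖a‖ = 1) {z : ℂ} (hz : z ∈ unitDisk) :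
    ‖peakFunction a z‖ ^ 2 ≤ 1 - ‖z - a‖ ^ 2 / 4 := by
  have h1 := parallelogram_law_with_norm ℝ (1 : ℂ) ((starRingEnd ℂ) a * z)
  rw [norm_one_sub_conj_mul ha, norm_one, norm_mul, RCLike.norm_conj, ha, one_mul] at h1
  have h2 := mem_ball_zero_iff.1 hz
  rw [peakFunction, norm_div, div_pow, Complex.norm_ofNat]
  nlinarith [norm_nonneg z]

theorem norm_peakFunction_le_one {a : ℂ} (ha : ‖a‖ = 1) {z : ℂ} (hz : z ∈ unitDisk) :
    ‖peakFunction a z‖ ≤ 1 := by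
  have := norm_peakFunction_sq ha hz
  nlinarith [norm_nonneg (peakFunction a z), sq_nonneg ‖z - a‖]

theorem peakFunction_self {a : ℂ} (ha : ‖a‖ = 1) : peakFunction a a = 1 := by
  rw [peakFunction, mul_comm, Complex.mul_conj, Complex.normSq_eq_norm_sq, ha]
  norm_num

theorem differentiable_peakFunction (a : ℂ) : Differentiable ℂ (peakFunction a) := by
  unfold peakFunction
  fun_prop

namespace IsAnalyticSpace

variable {s : ℝ} {N : (unitDisk → ℂ) → ENNReal} {X : Type*} [NormedAddCommGroup X]
  [NormedSpace ℂ X] {ι : X →ₗ[ℂ] (unitDisk → ℂ)} {φ ψ : ℂ → ℂ} {a c : ℂ}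

/-- The upper estimate. The weight is split by a high power of a function that peaks at `a`: the
part that vanishes at `a` gives a compact operator, the peaking part an operator of small norm. -/
theorem exists_isCompactOperator_norm_sub_le (hN : IsConformalNorm s N)
    (hX : IsAnalyticSpace N ι) (hs : 0 < s) (h : HasBoundaryDeriv φ a c)
    (haway : ∀ δ : ℝ, 0 < δ → ∃ r < 1, ∀ z ∈ unitDisk, δ ≤ ‖z - a‖ → ‖φ z‖ ≤ r)
    (hψd : DifferentiableOn ℂ ψ unitDisk) (hψb : ∃ C : ℝ, ∀ z ∈ unitDisk, ‖ψ z‖ ≤ C)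
    (hψ : Tendsto ψ (𝓝[unitDisk] a) (𝓝 (ψ a))) {T : X →L[ℂ] X}
    (hT : IsWeightedComposition ι h.mapsTo ψ T) {η : ℝ} (hη : 0 < η) :
    ∃ L : X →L[ℂ] X, IsCompactOperator L ∧ ‖T - L‖ ≤ ‖ψ a‖ / c.re ^ s + η := by
  obtain ⟨B, hB⟩ := hψb
  have hB0 : 0 ≤ B := (norm_nonneg _).trans (hB 0 (by simp))
  obtain ⟨C, hC0, hC⟩ := hN.exists_comp_le hs h.mapsTo h.diff
  set v := ‖ψ a‖ / c.re ^ s with hv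
  have hv0 : 0 ≤ v := by have := h.re_pos; positivity
  obtain ⟨ε, hε, hεη⟩ : ∃ ε > 0, ε + ε * C ≤ η := by
    refine ⟨η / (1 + C), by positivity, le_of_eq ?_⟩
    field_simp
  have hlim : Tendsto (fun z => ‖ψ z‖ / (‖(φ z - a) / (z - a)‖ ^ 2 / c.re) ^ s)
      (𝓝[unitDisk] a) (𝓝 v) :=
    hψ.norm.div (h.tendsto_julia.rpow_const (Or.inl h.re_pos.ne'))
      (Real.rpow_pos_of_pos h.re_pos s).ne'
  obtain ⟨δ, hδ, hball⟩ := Metric.mem_nhdsWithin_iff.1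
    (hlim.eventually (gt_mem_nhds (lt_add_of_pos_right v hε)))
  -- Outside the `δ`-neighbourhood of `a` a high power of the peak function is negligible.
  obtain ⟨n, hn⟩ : ∃ n : ℕ, B * (max 0 (1 - δ ^ 2 / 4)) ^ n ≤ ε := by
    have h1 : max 0 (1 - δ ^ 2 / 4) < 1 := max_lt one_pos (by linarith [pow_pos hδ 2])
    have h2 := (tendsto_pow_atTop_nhds_zero_of_lt_one (le_max_left _ _) h1).const_mul B
    rw [mul_zero] at h2
    obtain ⟨n, hn⟩ := (h2.eventually (gt_mem_nhds hε)).exists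
    exact ⟨n, hn.le⟩
  have hpd := (differentiable_peakFunction a).pow (2 * n)
  have hp1 : ∀ z ∈ unitDisk, ‖peakFunction a z ^ (2 * n)‖ ≤ 1 := fun z hz => by
    rw [norm_pow]
    exact pow_le_one₀ (norm_nonneg _) (norm_peakFunction_le_one h.norm_a hz)
  obtain ⟨L, hL⟩ := hX.exists_operator hN hs h.mapsTo h.diff
    (u := fun z => (1 - peakFunction a z ^ (2 * n)) * ψ z)
    ((hpd.const_sub 1).differentiableOn.mul hψd) ⟨2 * B, fun z hz => by
      rw [norm_mul]
      have h1 := norm_sub_le 1 (peakFunction a z ^ (2 * n))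
      rw [norm_one] at h1
      exact mul_le_mul (h1.trans (by linarith [hp1 z hz])) (hB z hz) (norm_nonneg _) zero_le_two⟩
  refine ⟨L, hX.isCompactOperator hN hs h.diff haway ⟨2 * B, fun z hz => ?_⟩ ?_ hL, ?_⟩
  · rw [norm_mul]
    have h1 := norm_sub_le 1 (peakFunction a z ^ (2 * n))
    rw [norm_one] at h1
    exact mul_le_mul (h1.trans (by linarith [hp1 z hz])) (hB z hz) (norm_nonneg _) zero_le_two
  · have h1 : Tendsto (fun z => 1 - peakFunction a z ^ (2 * n)) (𝓝[unitDisk] a)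
        (𝓝 (1 - peakFunction a a ^ (2 * n))) :=
      ((hpd.const_sub 1).continuous.tendsto a).mono_left nhdsWithin_le_nhds
    rw [peakFunction_self h.norm_a, one_pow, sub_self] at h1
    simpa using h1.mul hψ
  · have hTL : IsWeightedComposition ι h.mapsTo (fun z => peakFunction a z ^ (2 * n) * ψ z)
        (T - L) := fun f z => by
      rw [sub_apply, map_sub, Pi.sub_apply, hT, hL]
      ring
    refine (hX.norm_operator_le hN hs h hC0 hC hTL (A := v + ε) (by positivity) hε.le
      fun z hz => ?_).trans (by linarith)
    have hJ := Real.rpow_pos_of_pos (h.julia_pos hz) s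
    rw [norm_mul]
    by_cases hzδ : ‖z - a‖ < δ
    · have h1 : ‖ψ z‖ / (‖(φ z - a) / (z - a)‖ ^ 2 / c.re) ^ s < v + ε :=
        hball ⟨by rwa [Metric.mem_ball, dist_eq_norm], hz⟩
      rw [div_lt_iff₀ hJ] at h1
      have h2 := mul_le_mul_of_nonneg_right (hp1 z hz) (norm_nonneg (ψ z))
      linarith
    · have h1 := norm_peakFunction_sq h.norm_a hz
      have h2 : ‖peakFunction a z ^ (2 * n)‖ ≤ max 0 (1 - δ ^ 2 / 4) ^ n := by
        rw [norm_pow, pow_mul]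
        refine pow_le_pow_left₀ (by positivity) (h1.trans (le_max_of_le_right ?_)) n
        nlinarith [not_lt.1 hzδ]
      have h3 := mul_le_mul h2 (hB z hz) (norm_nonneg _) (by positivity)
      have h4 : 0 ≤ (v + ε) * (‖(φ z - a) / (z - a)‖ ^ 2 / c.re) ^ s := by positivity
      linarith

/-! ### The lower estimate -/

/-- The value of `T k` at `z`, for the test function `k` of the point `φ z`. -/
theorem weightQuotient_eq_testKernel {hφ : MapsTo φ unitDisk unitDisk} {T : X →L[ℂ] X}
    (hT : IsWeightedComposition ι hφ ψ T) (z : unitDisk) {k : X}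
    (hk : ι k = fun x : unitDisk => testKernel s (φ z) x) :
    ‖ι (T k) z‖ * (1 - ‖(z : ℂ)‖ ^ 2) ^ s = weightQuotient φ ψ s z := by
  have hφz := hφ z.2
  have h1 := one_sub_sq_pos hφz
  rw [hT, hk, norm_mul, norm_testKernel hφz (mem_ball_zero_iff.1 hφz).le, autFactor_self hφz,
    Real.inv_rpow h1.le, weightQuotient]
  ring

/-- The lower estimate when every element of the space is of little-o growth at `a`: a limit point
of the images of the test kernels under the compact operator is negligible at the points of
evaluation. -/
theorem le_norm_sub_of_littleO (hN : IsConformalNorm s N) (hX : IsAnalyticSpace N ι)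
    (h : HasBoundaryDeriv φ a c) (hψ : Tendsto ψ (𝓝[unitDisk] a) (𝓝 (ψ a)))
    (hlittle : ∀ f : X, ∀ F : ℂ → ℂ, DifferentiableOn ℂ F unitDisk →
      (∀ z : unitDisk, ι f z = F z) →
      Tendsto (fun z => ‖F z‖ * (1 - ‖z‖ ^ 2) ^ s) (𝓝[unitDisk] a) (𝓝 0))
    {T : X →L[ℂ] X} (hT : IsWeightedComposition ι h.mapsTo ψ T) {L : X →L[ℂ] X}
    (hL : IsCompactOperator L) : ‖ψ a‖ / c.re ^ s ≤ ‖T - L‖ := by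
  obtain ⟨r, hr⟩ := (𝓝[<] (1 : ℝ)).exists_seq_tendsto
  obtain ⟨m₀, hm₀⟩ := eventually_atTop.1 (hr.eventually eventually_mem_Ioo_nhdsLT_one)
  let z : ℕ → unitDisk := fun m => ⟨(r (m + m₀) : ℂ) * a,
    radial_mem h.norm_a (hm₀ _ (Nat.le_add_left _ _))⟩
  have hrm : Tendsto (fun m => r (m + m₀)) atTop (𝓝[<] 1) := hr.comp (tendsto_add_atTop_nat m₀)
  choose k hk1 hk using fun m => hX.exists_testKernel hN (h.mapsTo (z m).2)
  obtain ⟨K, hK, hKL⟩ := hL.image_closedBall_subset_compact (f := (L : X →ₗ[ℂ] X)) 1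
  obtain ⟨g, -, σ, hσ, hg⟩ := hK.isSeqCompact (x := fun m => L (k m)) fun m =>
    hKL ⟨k m, mem_closedBall_zero_iff.2 (hk1 m), rfl⟩
  obtain ⟨G, hG, hGg⟩ := hX.analytic g
  have hz : Tendsto (fun m => ((z (σ m) : unitDisk) : ℂ)) atTop (𝓝[unitDisk] a) :=
    (tendsto_radial h.norm_a).comp (hrm.comp hσ.tendsto_atTop)
  have h1 : Tendsto (fun m => weightQuotient φ ψ s (z (σ m))) atTop (𝓝 (‖ψ a‖ / c.re ^ s)) :=
    (h.tendsto_weightQuotient_radial hψ).comp (hrm.comp hσ.tendsto_atTop)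
  have h2 := (hlittle g G hG fun z => (hGg z).symm).comp hz
  have h3 := tendsto_iff_norm_sub_tendsto_zero.1 hg
  have h4 := (h1.sub h2).sub h3
  rw [sub_zero, sub_zero] at h4
  refine le_of_tendsto h4 (Eventually.of_forall fun m => ?_)
  have e1 := hX.norm_mul_le hN (T (k (σ m)) - g) (z (σ m))
  have e2 := weightQuotient_eq_testKernel (s := s) hT (z (σ m)) (hk (σ m))
  have e3 : ‖(T - L) (k (σ m))‖ ≤ ‖T - L‖ :=
    ((T - L).le_opNorm _).trans (mul_le_of_le_one_right (norm_nonneg _) (hk1 _))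
  have e4 : ‖T (k (σ m)) - g‖ ≤ ‖(T - L) (k (σ m))‖ + ‖L (k (σ m)) - g‖ := by
    refine le_trans (le_of_eq ?_) (norm_add_le _ _)
    rw [sub_apply]
    congr 1
    abel
  have e5 := norm_sub_norm_le (ι (T (k (σ m))) (z (σ m))) (G (z (σ m)))
  rw [map_sub, Pi.sub_apply, ← hGg] at e1
  have e6 := (Real.rpow_pos_of_pos (one_sub_sq_pos (z (σ m)).2) s).le
  have e7 := mul_le_mul_of_nonneg_right e5 e6
  simp only [Function.comp_apply]
  linarith

/-- The lower estimate when test functions concentrating at different scales do not add up. The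
compact operator nearly annihilates the difference of two of them, the first fixed and the second
chosen much closer to the boundary. -/
theorem le_norm_sub_of_separated (hN : IsConformalNorm s N) (hX : IsAnalyticSpace N ι)
    (hs : 0 < s) (h : HasBoundaryDeriv φ a c) (hψ : Tendsto ψ (𝓝[unitDisk] a) (𝓝 (ψ a)))
    (hψb : ∃ C : ℝ, ∀ z ∈ unitDisk, ‖ψ z‖ ≤ C)
    (hsep : ∀ w ∈ unitDisk, ∀ k : X, ι k = (fun x : unitDisk => testKernel s w x) → ∀ ε > 0,
      ∀ᶠ w' in 𝓝[unitDisk] a, ∀ k' : X, ι k' = (fun x : unitDisk => testKernel s w' x) →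
        ‖k' - k‖ ≤ 1 + ε)
    {T : X →L[ℂ] X} (hT : IsWeightedComposition ι h.mapsTo ψ T) {L : X →L[ℂ] X}
    (hL : IsCompactOperator L) : ‖ψ a‖ / c.re ^ s ≤ ‖T - L‖ := by
  obtain ⟨B, hB⟩ := hψb
  have hB0 : 0 ≤ B := (norm_nonneg _).trans (hB 0 (by simp))
  obtain ⟨r, hr⟩ := (𝓝[<] (1 : ℝ)).exists_seq_tendsto
  obtain ⟨m₀, hm₀⟩ := eventually_atTop.1 (hr.eventually eventually_mem_Ioo_nhdsLT_one)
  let z : ℕ → unitDisk := fun m => ⟨(r (m + m₀) : ℂ) * a,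
    radial_mem h.norm_a (hm₀ _ (Nat.le_add_left _ _))⟩
  have hrm : Tendsto (fun m => r (m + m₀)) atTop (𝓝[<] 1) := hr.comp (tendsto_add_atTop_nat m₀)
  choose k hk1 hk using fun m => hX.exists_testKernel hN (h.mapsTo (z m).2)
  obtain ⟨K, hK, hKL⟩ := hL.image_closedBall_subset_compact (f := (L : X →ₗ[ℂ] X)) 1
  obtain ⟨g, -, σ, hσ, hg⟩ := hK.isSeqCompact (x := fun m => L (k m)) fun m =>
    hKL ⟨k m, mem_closedBall_zero_iff.2 (hk1 m), rfl⟩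
  have hz : Tendsto (fun m => ((z (σ m) : unitDisk) : ℂ)) atTop (𝓝[unitDisk] a) :=
    (tendsto_radial h.norm_a).comp (hrm.comp hσ.tendsto_atTop)
  have hφz : Tendsto (fun m => φ (z (σ m))) atTop (𝓝[unitDisk] a) :=
    tendsto_nhdsWithin_iff.2 ⟨h.tendsto_self.comp hz,
      Eventually.of_forall fun m => h.mapsTo (z (σ m)).2⟩
  have h1 : Tendsto (fun m => weightQuotient φ ψ s (z (σ m))) atTop (𝓝 (‖ψ a‖ / c.re ^ s)) :=
    (h.tendsto_weightQuotient_radial hψ).comp (hrm.comp hσ.tendsto_atTop)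
  have h2 : Tendsto (fun m => (1 - ‖((z (σ m) : unitDisk) : ℂ)‖ ^ 2) ^ s) atTop (𝓝 0) := by
    have := (((tendsto_one_sub_norm_sq h.norm_a).mono_left nhdsWithin_le_nhds).comp hz).rpow_const
      (p := s) (Or.inr hs.le)
    rwa [Real.zero_rpow hs.ne'] at this
  have main : ∀ ε > (0 : ℝ), ‖ψ a‖ / c.re ^ s ≤ ‖T - L‖ * (1 + ε) + 2 * ε := by
    intro ε hε
    obtain ⟨n, hn⟩ := ((tendsto_iff_norm_sub_tendsto_zero.1 hg).eventually
      (gt_mem_nhds hε)).exists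
    set w := φ (z (σ n)) with hw
    have hwD : w ∈ unitDisk := h.mapsTo (z (σ n)).2
    obtain ⟨D, hD⟩ := exists_norm_testKernel_le hs hwD
    have h5 := ((h1.sub (h2.const_mul (B * D))).sub (tendsto_iff_norm_sub_tendsto_zero.1 hg))
    rw [mul_zero, sub_zero, sub_zero] at h5
    have h6 : ‖ψ a‖ / c.re ^ s ≤ ‖T - L‖ * (1 + ε) + ε := by
      refine le_of_tendsto h5 ?_
      filter_upwards [hφz.eventually (hsep w hwD (k (σ n)) (hk _) ε hε)] with m hm
      have hm1 := hm (k (σ m)) (hk _)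
      set q := k (σ m) - k (σ n) with hq
      have e1 := hX.norm_mul_le hN (T q) (z (σ m))
      have e2 := weightQuotient_eq_testKernel (s := s) hT (z (σ m)) (hk (σ m))
      have e3 : ‖(T - L) q‖ ≤ ‖T - L‖ * (1 + ε) :=
        ((T - L).le_opNorm _).trans (mul_le_mul_of_nonneg_left hm1 (norm_nonneg _))
      have e4 : ‖T q‖ ≤ ‖(T - L) q‖ + (‖L (k (σ m)) - g‖ + ‖L (k (σ n)) - g‖) := by
        have e : T q = (T - L) q + ((L (k (σ m)) - g) - (L (k (σ n)) - g)) := by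
          rw [sub_apply, hq, map_sub, map_sub]
          abel
        rw [e]
        exact (norm_add_le _ _).trans (add_le_add le_rfl (norm_sub_le _ _))
      have e6 := Real.rpow_pos_of_pos (one_sub_sq_pos (z (σ m)).2) s
      have e7 : ‖ι (T (k (σ n))) (z (σ m))‖ ≤ B * D := by
        rw [hT, hk, norm_mul]
        exact mul_le_mul (hB _ (z (σ m)).2) (hD _ (h.mapsTo (z (σ m)).2)) (norm_nonneg _) hB0
      have e5 := norm_sub_norm_le (ι (T (k (σ m))) (z (σ m))) (ι (T (k (σ n))) (z (σ m)))
      have e0 : T q = T (k (σ m)) - T (k (σ n)) := by rw [hq, map_sub]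
      rw [e0, map_sub, Pi.sub_apply, ← e0] at e1
      have e8 := mul_le_mul_of_nonneg_right
        ((sub_le_sub_left e7 ‖ι (T (k (σ m))) (z (σ m))‖).trans e5) e6.le
      simp only [Function.comp_apply] at hn ⊢
      rw [sub_mul, e2] at e8
      linarith
    linarith
  refine le_of_forall_pos_le_add fun η hη => ?_
  have hpos : 0 < ‖T - L‖ + 2 := by positivity
  refine (main (η / (‖T - L‖ + 2)) (by positivity)).trans (le_of_eq ?_)
  field_simp
  ring

/-- The essential norm, from the two estimates. -/
theorem essentialNorm_eq {T : X →L[ℂ] X} {v : ℝ}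
    (hle : ∀ η > 0, ∃ L : X →L[ℂ] X, IsCompactOperator L ∧ ‖T - L‖ ≤ v + η)
    (hge : ∀ L : X →L[ℂ] X, IsCompactOperator L → v ≤ ‖T - L‖) : essentialNorm T = v := by
  rw [essentialNorm]
  apply le_antisymm
  · refine le_of_forall_pos_le_add fun η hη => ?_
    obtain ⟨L, hL, hle⟩ := hle η hη
    have hm : ‖T - L‖ ∈ {r : ℝ | ∃ L : X →L[ℂ] X, IsCompactOperator L ∧ r = ‖T - L‖} :=
      ⟨L, hL, rfl⟩
    refine (csInf_le ⟨0, ?_⟩ hm).trans hle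
    rintro _ ⟨L', -, rfl⟩
    exact norm_nonneg _
  · obtain ⟨L, hL, -⟩ := hle 1 one_pos
    refine le_csInf ⟨_, L, hL, rfl⟩ ?_
    rintro _ ⟨L', hL', rfl⟩
    exact hge L' hL'

end IsAnalyticSpace

/-! ### The weighted Bergman spaces -/

theorem measurable_weight (α : ℝ) : Measurable fun x : ℝ => ENNReal.ofReal ((1 - x ^ 2) ^ α) := by
  fun_prop

theorem lintegral_weightedArea {α : ℝ} (hα : -1 < α) (H : ℂ → ENNReal) :
    ∫⁻ z, H z ∂(weightedArea α) = ENNReal.ofReal ((1 + α) / Real.pi) *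
      ∫⁻ z in unitDisk, H z * ENNReal.ofReal ((1 - ‖z‖ ^ 2) ^ α) := by
  have hm : Measurable (fun z : unitDisk =>
      ENNReal.ofReal ((1 + α) * (1 - ‖(z : ℂ)‖ ^ 2) ^ α / Real.pi)) := by fun_prop
  have hpi := Real.pi_pos
  rw [weightedArea, lintegral_withDensity_eq_lintegral_mul_non_measurable _ hm
    (Eventually.of_forall fun z => ENNReal.ofReal_lt_top)]
  have h := lintegral_subtype_comap (μ := (volume : Measure ℂ))
    (Metric.isOpen_ball (x := (0 : ℂ)) (ε := 1)).measurableSet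
    (fun z => ENNReal.ofReal ((1 + α) * (1 - ‖z‖ ^ 2) ^ α / Real.pi) * H z)
  refine h.trans ?_
  rw [← lintegral_const_mul' _ _ ENNReal.ofReal_ne_top]
  refine lintegral_congr fun z => ?_
  have e : (1 + α) * (1 - ‖z‖ ^ 2) ^ α / Real.pi =
      (1 + α) / Real.pi * (1 - ‖z‖ ^ 2) ^ α := by ring
  rw [e, ENNReal.ofReal_mul (by have : 0 < 1 + α := by linarith
                                positivity)]
  ring

/-- The area of the disc for the weight `(1 - |z|²)^α`, computed in polar coordinates. -/
theorem lintegral_unitDisk_weight {α : ℝ} (hα : -1 < α) :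
    ∫⁻ z in unitDisk, ENNReal.ofReal ((1 - ‖z‖ ^ 2) ^ α) =
      ENNReal.ofReal (Real.pi / (1 + α)) := by
  have hpi := Real.pi_pos
  have hα1 : 0 < 1 + α := by linarith
  have h1 := lintegral_unitDisk_polar (h := fun _ => (1 : ℝ)) continuousOn_const
    (fun _ => zero_le_one) (measurable_weight α)
  simp only [ENNReal.ofReal_one, one_mul, Real.circleAverage_const, mul_one] at h1
  rw [h1]
  let G : ℝ → ℝ := fun r => -(Real.pi / (1 + α)) * (1 - r ^ 2) ^ (1 + α)
  let g : ℝ → ℝ := fun r => 2 * Real.pi * r * (1 - r ^ 2) ^ α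
  have hc : ContinuousOn G (Icc 0 1) := by
    refine Continuous.continuousOn (continuous_const.mul ?_)
    exact Continuous.rpow_const (by fun_prop) fun _ => Or.inr hα1.le
  have hd : ∀ r ∈ Ioo (0 : ℝ) 1, HasDerivAt G (g r) r := by
    intro r hr
    have hp : 0 < 1 - r ^ 2 := by nlinarith [hr.1, hr.2]
    have h2 := (((hasDerivAt_pow 2 r).const_sub 1).rpow_const (p := 1 + α)
      (Or.inl hp.ne')).const_mul (-(Real.pi / (1 + α)))
    refine h2.congr_deriv ?_
    have e : 1 + α - 1 = α := by ring
    simp only [g, e]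
    field_simp
    push_cast
    ring
  have hg0 : ∀ r ∈ Ioo (0 : ℝ) 1, 0 ≤ g r := fun r hr => by
    have hp : 0 < 1 - r ^ 2 := by nlinarith [hr.1, hr.2]
    have := hr.1
    simp only [g]
    positivity
  have hint := intervalIntegral.integrableOn_deriv_of_nonneg hc hd hg0
  have h3 := intervalIntegral.integral_eq_sub_of_hasDerivAt_of_le zero_le_one hc hd
    ((intervalIntegrable_iff_integrableOn_Ioc_of_le zero_le_one).2 hint)
  have e1 : G 1 - G 0 = Real.pi / (1 + α) := by
    simp [G, Real.zero_rpow hα1.ne']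
  rw [e1, intervalIntegral.integral_of_le zero_le_one, integral_Ioc_eq_integral_Ioo] at h3
  rw [← h3, ofReal_integral_eq_lintegral_ofReal (hint.mono_set Ioo_subset_Ioc_self)
    (ae_restrict_of_forall_mem measurableSet_Ioo hg0)]
  refine setLIntegral_congr_fun measurableSet_Ioo fun r hr => ?_
  have hp : 0 < 1 - r ^ 2 := by nlinarith [hr.1, hr.2]
  have hr0 := hr.1
  simp only [g]
  rw [← ENNReal.ofReal_mul hr0.le, ← ENNReal.ofReal_mul (by positivity)]
  congr 1
  ring

section Bergman

variable {p α s : ℝ}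

theorem eLpNorm_weightedArea (hp : 1 ≤ p) (hα : -1 < α) (G : ℂ → ℂ) :
    eLpNorm (fun z : unitDisk => G z) (ENNReal.ofReal p) (weightedArea α) =
      (ENNReal.ofReal ((1 + α) / Real.pi) * ∫⁻ z in unitDisk, ENNReal.ofReal (‖G z‖ ^ p) *
        ENNReal.ofReal ((1 - ‖z‖ ^ 2) ^ α)) ^ (1 / p) := by
  have hp0 : 0 < p := by linarith
  rw [eLpNorm_eq_lintegral_rpow_enorm_toReal (by simpa using hp0) ENNReal.ofReal_ne_top,
    ENNReal.toReal_ofReal hp0.le, ← lintegral_weightedArea hα]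
  congr 1
  refine lintegral_congr fun z => ?_
  rw [← ofReal_norm, ENNReal.ofReal_rpow_of_nonneg (norm_nonneg _) hp0.le]

/-- The norm of the weighted Bergman space is conformal, of weight `(2 + α) / p`, by the sharp
subordination inequality. -/
theorem isConformalNorm_bergman (hp : 1 ≤ p) (hα : -1 < α) (hs : s = (2 + α) / p) :
    IsConformalNorm s fun g => eLpNorm g (ENNReal.ofReal p) (weightedArea α) where
  mono _ _ h := eLpNorm_mono h
  add_le _ _ hg hh :=
    eLpNorm_add_le hg.aestronglyMeasurable hh.aestronglyMeasurable (by simpa using hp)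
  smul c g := eLpNorm_const_smul c g _ _
  one := by
    have h := eLpNorm_weightedArea hp hα fun _ => 1
    simp only [norm_one, Real.one_rpow, ENNReal.ofReal_one, one_mul] at h
    have hpi := Real.pi_pos
    have hα1 : 0 < 1 + α := by linarith
    rw [lintegral_unitDisk_weight hα, ← ENNReal.ofReal_mul (by positivity)] at h
    have e : (1 + α) / Real.pi * (Real.pi / (1 + α)) = 1 := by field_simp
    rw [e, ENNReal.ofReal_one, ENNReal.one_rpow] at h
    exact h
  fatou g h hg hlim := Lp.eLpNorm_lim_le_liminf_eLpNorm
    (fun n => (hg n).aestronglyMeasurable) h (Eventually.of_forall hlim)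
  conformal f φ b hf hφ hd hb := by
    have hp0 : 0 < p := by linarith
    have e := eLpNorm_weightedArea hp hα fun z =>
      (((autFactor b z / autFactor (φ b) (φ z)) ^ s * ‖f (φ z)‖ : ℝ) : ℂ)
    rw [e, eLpNorm_weightedArea hp hα f]
    refine ENNReal.rpow_le_rpow (mul_le_mul_right ?_ _) (by positivity)
    refine le_trans (le_of_eq ?_) (lintegral_comp_mul_autFactor_le hp hs hf hφ hd hb)
    refine setLIntegral_congr_fun Metric.isOpen_ball.measurableSet fun z hz => ?_
    have h1 := autFactor_pos hb (mem_ball_zero_iff.1 hz).le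
    have h2 := autFactor_pos (hφ hb) (mem_ball_zero_iff.1 (hφ hz)).le
    simp only [Complex.norm_real]
    rw [Real.norm_of_nonneg (by positivity)]

/-- Evaluation of the elements of the Bergman space, as a linear map. -/
noncomputable def bergmanEval (p α : ℝ) (hp : 1 ≤ p) (hα : -1 < α) :
    BergmanSpace p α hp hα →ₗ[ℂ] (unitDisk → ℂ) where
  toFun f := fun z => f z
  map_add' _ _ := rfl
  map_smul' _ _ := rfl

theorem isAnalyticSpace_bergman (hp : 1 ≤ p) (hα : -1 < α) :
    IsAnalyticSpace (fun g => eLpNorm g (ENNReal.ofReal p) (weightedArea α))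
      (bergmanEval p α hp hα) where
  injective _ _ h := Subtype.ext h
  analytic f := f.2.1
  enorm_eq f := by
    rw [← ofReal_norm, BergmanSpace.norm_eq_eLpNorm, ENNReal.ofReal_toReal f.memLp.2.ne]
    rfl
  exists_eq g hg hfin :=
    ⟨⟨g, hg, (bergman_memLp_iff hp hg).1
      ⟨hg.continuous.aestronglyMeasurable, lt_top_iff_ne_top.2 hfin⟩⟩, rfl⟩

/-- Functions in the weighted Bergman space are of little-o growth at the boundary: the value at
`b` is controlled by the integral over a pseudohyperbolic disc about `b`, which moves out to the
boundary with `b`. -/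
theorem tendsto_norm_mul_of_bergman (hp : 1 ≤ p) (hα : -1 < α) (hs : s = (2 + α) / p)
    {a : ℂ} (ha : ‖a‖ = 1) {F : ℂ → ℂ} (hF : DifferentiableOn ℂ F unitDisk)
    (hfin : ∫⁻ z in unitDisk, ENNReal.ofReal (‖F z‖ ^ p) *
      ENNReal.ofReal ((1 - ‖z‖ ^ 2) ^ α) ≠ ⊤) :
    Tendsto (fun z => ‖F z‖ * (1 - ‖z‖ ^ 2) ^ s) (𝓝[unitDisk] a) (𝓝 0) := by
  have hp0 : 0 < p := by linarith
  have hsp : s * p = 2 + α := by rw [hs]; field_simp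
  have hD : MeasurableSet unitDisk := Metric.isOpen_ball.measurableSet
  -- The pseudohyperbolic disc of radius `1 / 2` about `b` is cut out by `χ ‖diskAut b z‖`.
  let χ : ℝ → ENNReal := (Iio (1 / 2)).indicator 1
  have hχ : Measurable χ := measurable_one.indicator measurableSet_Iio
  let W : ℝ → ENNReal := fun x => χ x * ENNReal.ofReal ((1 - x ^ 2) ^ α)
  have hχ1 : ∀ x, χ x ≤ 1 := fun x => indicator_le_self' (fun _ _ => zero_le) x
  have hW : Measurable W := hχ.mul (measurable_weight α)
  have hWn : Measurable fun z : ℂ => W ‖z‖ := hW.comp measurable_norm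
  have hWt : ∀ x, W x ≠ ⊤ := fun x =>
    ENNReal.mul_ne_top (ne_top_of_le_ne_top ENNReal.one_ne_top (hχ1 x)) ENNReal.ofReal_ne_top
  set κ := ∫⁻ z in unitDisk, W ‖z‖ with hκ
  have hκ0 : κ ≠ 0 := by
    intro h0
    rw [hκ, lintegral_eq_zero_iff hWn] at h0
    have h1 : ∀ᵐ z ∂(volume : Measure ℂ), z ∈ unitDisk → W ‖z‖ = 0 :=
      (ae_restrict_iff' hD).1 h0
    have h2 : (volume : Measure ℂ) (Metric.ball (0 : ℂ) (1 / 2)) = 0 := by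
      refine measure_mono_null (fun z hz => ?_) h1
      intro hcon
      have hz1 := mem_ball_zero_iff.1 hz
      have h3 := hcon (mem_ball_zero_iff.2 (hz1.trans (by norm_num)))
      have h4 : 0 < 1 - ‖z‖ ^ 2 := by nlinarith [norm_nonneg z]
      have h5 : χ ‖z‖ = 1 := by simp only [χ]; rw [indicator_of_mem (mem_Iio.2 hz1)]; rfl
      simp only [W, h5, one_mul, ENNReal.ofReal_eq_zero] at h3
      exact absurd h3 (not_le.2 (Real.rpow_pos_of_pos h4 α))
    exact (Metric.measure_ball_pos volume (0 : ℂ) (by norm_num : (0 : ℝ) < 1 / 2)).ne' h2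
  have hκt : κ ≠ ⊤ := by
    have h1 : κ ≤ ∫⁻ z in unitDisk, ENNReal.ofReal ((1 - ‖z‖ ^ 2) ^ α) :=
      lintegral_mono fun z => mul_le_of_le_one_left zero_le (hχ1 _)
    rw [lintegral_unitDisk_weight hα] at h1
    exact ne_top_of_le_ne_top ENNReal.ofReal_ne_top h1
  let I : ℂ → ENNReal := fun b => ∫⁻ z in unitDisk, (χ ‖diskAut b z‖ *
    ENNReal.ofReal (‖F z‖ ^ p)) * ENNReal.ofReal ((1 - ‖z‖ ^ 2) ^ α)
  -- Littlewood's principle for the constant self-map `0` is the submean value inequality.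
  have hle : ∀ b ∈ unitDisk, ENNReal.ofReal ((‖F b‖ * (1 - ‖b‖ ^ 2) ^ s) ^ p) * κ ≤ I b := by
    intro b hb
    let g : ℂ → ℂ := fun w => testKernel s b w * F (diskAut b w)
    have hg : DifferentiableOn ℂ g unitDisk := (differentiableOn_testKernel hb s).mul
      (hF.comp (differentiableOn_diskAut hb) fun _ hz => diskAut_mem hb hz)
    have h1 := lintegral_comp_le hp hg (ω := fun _ => 0) (differentiableOn_const 0) rfl
      (fun _ _ => by simp) hW hWt
    have h2 : ‖g 0‖ = ‖F b‖ * (1 - ‖b‖ ^ 2) ^ s := by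
      simp only [g]
      rw [norm_mul, norm_testKernel hb (by simp), diskAut_zero, autFactor]
      simp [mul_comm]
    rw [h2, lintegral_const_mul _ hWn] at h1
    refine h1.trans (le_of_eq ?_)
    simp only [I]
    rw [lintegral_comp_diskAut hb]
    refine setLIntegral_congr_fun hD fun z hz => ?_
    have hz1 := (mem_ball_zero_iff.1 hz).le
    have hpos := autFactor_pos hb hz1
    have h3 : ‖g z‖ ^ p = ‖F (diskAut b z)‖ ^ p * autFactor b z ^ (2 + α) := by
      simp only [g]
      rw [norm_mul, norm_testKernel hb hz1, Real.mul_rpow (by positivity) (norm_nonneg _),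
        ← Real.rpow_mul hpos.le, hsp, mul_comm]
    simp only [W]
    rw [h3, diskAut_diskAut hb hz, ENNReal.ofReal_mul (by positivity),
      ENNReal.ofReal_mul (by positivity)]
    ring
  have hI : Tendsto I (𝓝[unitDisk] a) (𝓝 0) := by
    have h0 : (0 : ENNReal) = ∫⁻ _ in unitDisk, (0 : ENNReal) ∂(volume : Measure ℂ) := by simp
    rw [h0]
    refine tendsto_lintegral_filter_of_dominated_convergence'
      (fun z => ENNReal.ofReal (‖F z‖ ^ p) * ENNReal.ofReal ((1 - ‖z‖ ^ 2) ^ α))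
      (Eventually.of_forall fun b => ?_) (Eventually.of_forall fun b =>
        Eventually.of_forall fun z => ?_) hfin ?_
    · have hd : Measurable fun z => diskAut b z :=
        (measurable_const.sub measurable_id).div
          (measurable_const.sub (measurable_const.mul measurable_id))
      have hFm : AEMeasurable (fun z => ENNReal.ofReal (‖F z‖ ^ p)) (volume.restrict unitDisk) :=
        ((hF.continuousOn.norm.rpow_const fun _ _ => Or.inr hp0.le).aemeasurable hD).ennreal_ofReal
      exact (((hχ.comp hd.norm).aemeasurable).mul hFm).mul
        ((measurable_weight α).comp measurable_norm).aemeasurable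
    · exact mul_le_mul_left (mul_le_of_le_one_left zero_le (hχ1 _)) _
    · refine ae_restrict_of_forall_mem hD fun z hz => ?_
      refine tendsto_const_nhds.congr' ?_
      have hz1 := (mem_ball_zero_iff.1 hz).le
      -- As `b` tends to `a`, the point `diskAut b z` leaves every compact part of the disc.
      have h1 : Tendsto (fun b => autFactor b z) (𝓝[unitDisk] a) (𝓝 0) := by
        have hc : ContinuousAt (fun b => autFactor b z) a := by
          have h2 : ‖1 - (starRingEnd ℂ) a * z‖ ^ 2 ≠ 0 := by
            rw [norm_one_sub_conj_mul ha]
            have : z - a ≠ 0 := by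
              intro h
              rw [sub_eq_zero] at h
              have := mem_ball_zero_iff.1 hz
              rw [h, ha] at this
              exact lt_irrefl _ this
            positivity
          unfold autFactor
          refine ContinuousAt.div (by fun_prop) ?_ h2
          have := Complex.continuous_conj
          exact Continuous.continuousAt (by fun_prop)
        have h3 := hc.tendsto
        rw [show autFactor a z = 0 by rw [autFactor, ha]; simp] at h3
        exact h3.mono_left nhdsWithin_le_nhds
      filter_upwards [h1.eventually (gt_mem_nhds (by norm_num : (0 : ℝ) < 1 / 2)),
        self_mem_nhdsWithin] with b hb hbD
      have h4 := one_sub_norm_diskAut_sq hbD hz1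
      have h5 : χ ‖diskAut b z‖ = 0 := by
        refine indicator_of_notMem (fun h => ?_) _
        have h6 : ‖diskAut b z‖ < 1 / 2 := h
        have h7 := autFactor_pos hbD hz1
        nlinarith [norm_nonneg (diskAut b z), norm_nonneg z]
      rw [h5, zero_mul, zero_mul]
  have h1 : Tendsto (fun b => ENNReal.ofReal ((‖F b‖ * (1 - ‖b‖ ^ 2) ^ s) ^ p))
      (𝓝[unitDisk] a) (𝓝 0) := by
    have h2 : Tendsto (fun b => I b / κ) (𝓝[unitDisk] a) (𝓝 0) := by
      have := ENNReal.Tendsto.div_const hI (Or.inr hκ0)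
      rwa [ENNReal.zero_div] at this
    refine tendsto_of_tendsto_of_tendsto_of_le_of_le' tendsto_const_nhds h2
      (Eventually.of_forall fun _ => zero_le) ?_
    filter_upwards [self_mem_nhdsWithin] with b hb
    rw [ENNReal.le_div_iff_mul_le (Or.inl hκ0) (Or.inl hκt)]
    exact hle b hb
  have h2 := (((ENNReal.tendsto_toReal ENNReal.zero_ne_top).comp h1).rpow_const
    (p := 1 / p) (Or.inr (by positivity)))
  rw [ENNReal.toReal_zero, Real.zero_rpow (by positivity)] at h2
  refine h2.congr' ?_
  filter_upwards [self_mem_nhdsWithin] with b hb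
  have h3 := one_sub_sq_pos hb
  have h4 : 0 ≤ ‖F b‖ * (1 - ‖b‖ ^ 2) ^ s := by positivity
  rw [Function.comp_apply, ENNReal.toReal_ofReal (by positivity), ← Real.rpow_mul h4,
    mul_one_div_cancel hp0.ne', Real.rpow_one]

end Bergman

/-! ### The weighted spaces with supremum norm -/

section Korenblum

variable {s : ℝ}

/-- The weighted supremum of a function on the disc, as an extended real number. -/
noncomputable def weightedSup (s : ℝ) (g : unitDisk → ℂ) : ENNReal :=
  ⨆ z : unitDisk, ‖g z‖ₑ * ENNReal.ofReal ((1 - ‖(z : ℂ)‖ ^ 2) ^ s)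

/-- For the weighted supremum the conformal inequality is the Schwarz–Pick inequality. -/
theorem isConformalNorm_weightedSup (hs : 0 < s) : IsConformalNorm s (weightedSup s) where
  mono g h hle := iSup_mono fun z => mul_le_mul_left (by
    rw [← ofReal_norm, ← ofReal_norm]
    exact ENNReal.ofReal_le_ofReal (hle z)) _
  add_le g h _ _ := iSup_le fun z => by
    refine (mul_le_mul_left (enorm_add_le (g z) (h z)) _).trans ?_
    rw [add_mul]
    exact add_le_add (le_iSup (fun z : unitDisk => ‖g z‖ₑ * _) z)
      (le_iSup (fun z : unitDisk => ‖h z‖ₑ * _) z)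
  smul c g := by
    simp only [weightedSup, ENNReal.mul_iSup, Pi.smul_apply, enorm_smul, mul_assoc]
  one := by
    apply le_antisymm
    · refine iSup_le fun z => ?_
      have h1 := one_sub_sq_pos z.2
      simp only [Pi.one_apply, enorm_one, one_mul, ENNReal.ofReal_le_one]
      exact Real.rpow_le_one h1.le (by linarith [sq_nonneg ‖(z : ℂ)‖]) hs.le
    · refine le_trans (le_of_eq ?_) (le_iSup (fun z : unitDisk => ‖(1 : unitDisk → ℂ) z‖ₑ *
        ENNReal.ofReal ((1 - ‖(z : ℂ)‖ ^ 2) ^ s)) ⟨0, by simp⟩)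
      simp
  fatou g h _ hlim := iSup_le fun z => by
    have h1 : Tendsto (fun n => ‖g n z‖ₑ * ENNReal.ofReal ((1 - ‖(z : ℂ)‖ ^ 2) ^ s)) atTop
        (𝓝 (‖h z‖ₑ * ENNReal.ofReal ((1 - ‖(z : ℂ)‖ ^ 2) ^ s))) :=
      ENNReal.Tendsto.mul_const (hlim z).enorm (Or.inr ENNReal.ofReal_ne_top)
    rw [← h1.liminf_eq]
    exact liminf_le_liminf (Eventually.of_forall fun n =>
      le_iSup (fun z : unitDisk => ‖g n z‖ₑ * _) z)
  conformal f φ b hf hφ hd hb := iSup_le fun z => by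
    refine le_trans ?_ (le_iSup (fun z : unitDisk => ‖f z‖ₑ *
      ENNReal.ofReal ((1 - ‖(z : ℂ)‖ ^ 2) ^ s)) ⟨φ z, hφ z.2⟩)
    have h1 := autFactor_pos hb (mem_ball_zero_iff.1 z.2).le
    have h2 := autFactor_pos (hφ hb) (mem_ball_zero_iff.1 (hφ z.2)).le
    have h3 := one_sub_sq_pos z.2
    have h4 := one_sub_sq_pos (hφ z.2)
    rw [← ofReal_norm, ← ofReal_norm, Complex.norm_real, Real.norm_of_nonneg (by positivity),
      ← ENNReal.ofReal_mul (by positivity), ← ENNReal.ofReal_mul (by positivity)]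
    refine ENNReal.ofReal_le_ofReal ?_
    have h5 : autFactor b z / autFactor (φ b) (φ z) * (1 - ‖(z : ℂ)‖ ^ 2) ≤ 1 - ‖φ z‖ ^ 2 := by
      rw [div_mul_eq_mul_div, div_le_iff₀ h2, mul_comm (1 - ‖φ z‖ ^ 2)]
      exact schwarzPick hφ hd hb z.2
    have h6 := Real.rpow_le_rpow (by positivity) h5 hs.le
    rw [Real.mul_rpow (by positivity) h3.le] at h6
    have h7 := mul_le_mul_of_nonneg_left h6 (norm_nonneg (f (φ z)))
    linarith

/-- Evaluation of the elements of the weighted space, as a linear map. -/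
noncomputable def korenblumEval (s : ℝ) : KorenblumSpace s →ₗ[ℂ] (unitDisk → ℂ) where
  toFun f := fun z => f z
  map_add' _ _ := rfl
  map_smul' _ _ := rfl

theorem isAnalyticSpace_korenblum (s : ℝ) :
    IsAnalyticSpace (weightedSup s) (korenblumEval s) where
  injective _ _ h := Subtype.ext h
  analytic f := f.2.1
  enorm_eq f := by
    have key : ∀ z : unitDisk, ‖korenblumEval s f z‖ₑ *
        ENNReal.ofReal ((1 - ‖(z : ℂ)‖ ^ 2) ^ s) =
        ENNReal.ofReal (‖f z‖ * (1 - ‖(z : ℂ)‖ ^ 2) ^ s) := fun z => by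
      rw [← ofReal_norm, ENNReal.ofReal_mul (norm_nonneg _)]
      rfl
    rw [← ofReal_norm, weightedSup]
    simp only [key]
    apply le_antisymm
    · exact iSup_le fun z => ENNReal.ofReal_le_ofReal (KorenblumSpace.le_norm f z)
    · by_cases htop : (⨆ z : unitDisk,
          ENNReal.ofReal (‖f z‖ * (1 - ‖(z : ℂ)‖ ^ 2) ^ s)) = ⊤
      · rw [htop]
        exact le_top
      · refine ENNReal.ofReal_le_of_le_toReal ?_
        have : Nonempty unitDisk := ⟨⟨0, by simp⟩⟩
        rw [KorenblumSpace.norm_def]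
        refine ciSup_le fun z => (ENNReal.ofReal_le_iff_le_toReal htop).1 ?_
        exact le_iSup (fun z : unitDisk =>
          ENNReal.ofReal (‖f z‖ * (1 - ‖(z : ℂ)‖ ^ 2) ^ s)) z
  exists_eq g hg hfin := by
    refine ⟨⟨g, hg, (weightedSup s g).toReal, ?_⟩, rfl⟩
    rintro _ ⟨z, rfl⟩
    refine (ENNReal.ofReal_le_iff_le_toReal hfin).1 ?_
    rw [ENNReal.ofReal_mul (norm_nonneg _), ofReal_norm]
    exact le_iSup (fun z : unitDisk => ‖g z‖ₑ *
      ENNReal.ofReal ((1 - ‖(z : ℂ)‖ ^ 2) ^ s)) z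

/-- Test functions that concentrate at different distances from the boundary have nearly disjoint
peaks, so that their difference has norm close to one. -/
theorem eventually_norm_sub_testKernel_le (hs : 0 < s) {a : ℂ} (ha : ‖a‖ = 1) {w : ℂ}
    (hw : w ∈ unitDisk) {k : KorenblumSpace s}
    (hk : korenblumEval s k = fun x : unitDisk => testKernel s w x) {ε : ℝ} (hε : 0 < ε) :
    ∀ᶠ w' in 𝓝[unitDisk] a, ∀ k' : KorenblumSpace s,
      korenblumEval s k' = (fun x : unitDisk => testKernel s w' x) → ‖k' - k‖ ≤ 1 + ε := by
  have hker : ∀ b ∈ unitDisk, ∀ z ∈ unitDisk,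
      ‖testKernel s b z‖ * (1 - ‖z‖ ^ 2) ^ s ≤ 1 := by
    intro b hb z hz
    have hz1 := (mem_ball_zero_iff.1 hz).le
    have h1 := one_sub_norm_diskAut_sq hb hz1
    have h2 := mul_pos (autFactor_pos hb hz1) (one_sub_sq_pos hz)
    rw [norm_testKernel hb hz1, ← Real.mul_rpow (autFactor_pos hb hz1).le (one_sub_sq_pos hz).le]
    exact Real.rpow_le_one h2.le (by nlinarith [sq_nonneg ‖diskAut b z‖]) hs.le
  obtain ⟨D, hD⟩ := exists_norm_testKernel_le hs hw
  have hD0 : 0 ≤ D := (norm_nonneg _).trans (hD 0 (by simp))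
  obtain ⟨t, ht, htε⟩ : ∃ t > (0 : ℝ), D * t ^ s ≤ ε := by
    have h1 : Tendsto (fun t : ℝ => D * t ^ s) (𝓝[>] 0) (𝓝 (D * 0 ^ s)) :=
      ((tendsto_id.mono_left nhdsWithin_le_nhds).rpow_const (Or.inr hs.le)).const_mul D
    rw [Real.zero_rpow hs.ne', mul_zero] at h1
    obtain ⟨t, h2, h3⟩ := ((h1.eventually (gt_mem_nhds hε)).and self_mem_nhdsWithin).exists
    exact ⟨t, h3, h2.le⟩
  have hsmall : ∀ᶠ w' in 𝓝[unitDisk] a, ((1 - ‖w'‖ ^ 2) / (t / 2) ^ 2) ^ s < ε := by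
    have h1 := (((tendsto_one_sub_norm_sq ha).mono_left
      (nhdsWithin_le_nhds (s := unitDisk))).div_const ((t / 2) ^ 2)).rpow_const
      (p := s) (Or.inr hs.le)
    rw [zero_div, Real.zero_rpow hs.ne'] at h1
    exact h1.eventually (gt_mem_nhds hε)
  filter_upwards [hsmall, self_mem_nhdsWithin] with w' hw' hw'D k' hk'
  have : Nonempty unitDisk := ⟨⟨0, by simp⟩⟩
  rw [KorenblumSpace.norm_def]
  refine ciSup_le fun z => ?_
  have e : (k' - k : KorenblumSpace s) z = testKernel s w' z - testKernel s w z := by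
    have h1 := congrFun (map_sub (korenblumEval s) k' k) z
    rw [hk, hk'] at h1
    exact h1
  have hz1 := mem_ball_zero_iff.1 z.2
  have hz0 := one_sub_sq_pos z.2
  rw [e]
  have h2 := mul_le_mul_of_nonneg_right (norm_sub_le (testKernel s w' z) (testKernel s w z))
    (Real.rpow_pos_of_pos hz0 s).le
  have h3 := hker w' hw'D z z.2
  have h4 := hker w hw z z.2
  rw [add_mul] at h2
  rcases le_or_gt (1 - ‖(z : ℂ)‖ ^ 2) t with hzt | hzt
  · -- Close to the boundary the fixed test function is small.
    have h5 := Real.rpow_le_rpow hz0.le hzt hs.le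
    have h6 := mul_le_mul (hD z z.2) h5 (Real.rpow_pos_of_pos hz0 s).le hD0
    linarith
  · -- On a compact part of the disc the moving test function is small.
    have h5 : ‖testKernel s w' z‖ ≤ ε := by
      rw [norm_testKernel hw'D hz1.le]
      refine (Real.rpow_le_rpow (autFactor_pos hw'D hz1.le).le
        ((autFactor_le hw'D hz1.le).trans ?_) hs.le).trans hw'.le
      have h6 := (one_sub_sq_pos hw'D).le
      have h7 := (mem_ball_zero_iff.1 hw'D).le
      gcongr
      nlinarith [norm_nonneg (z : ℂ), norm_nonneg w']
    have h6 : (1 - ‖(z : ℂ)‖ ^ 2) ^ s ≤ 1 :=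
      Real.rpow_le_one hz0.le (by linarith [sq_nonneg ‖(z : ℂ)‖]) hs.le
    have h7 := mul_le_mul h5 h6 (Real.rpow_pos_of_pos hz0 s).le hε.le
    linarith

end Korenblum

/-! ### The essential norm of the weighted composition operator -/

theorem mainTheorem9 (φ φ' ψ : ℂ → ℂ) (a : ℂ) (ρ : ℝ)
    (hφ : MapsTo φ unitDisk unitDisk)
    (hφ' : ∀ z ∈ unitDisk, HasDerivAt φ (φ' z) z)
    (ha : ‖a‖ = 1)
    (hfix : HasAngularLimit φ a a)
    (hlim : ∀ w : ℂ, ‖w‖ = 1 → (limsup (fun z => ‖φ z‖) (𝓝[unitDisk] w) = 1 ↔ w = a))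
    (hang : HasAngularDerivAt φ a (φ' a))
    (hψ : DifferentiableOn ℂ ψ unitDisk)
    (hψb : ∃ C : ℝ, ∀ z ∈ unitDisk, ‖ψ z‖ ≤ C)
    (hρ : 0 < ρ)
    (hφ'c : ContinuousOn φ' (unitDisk ∪ (Metric.closedBall 0 1 ∩ Metric.ball a ρ)))
    (hψc : ContinuousOn ψ (unitDisk ∪ (Metric.closedBall 0 1 ∩ Metric.ball a ρ))) :
    ((φ' a).im = 0 ∧ 0 < (φ' a).re) ∧
    (∀ (p α s : ℝ) (hp : 1 ≤ p) (hα : -1 < α), s = (2 + α) / p → InjOn φ unitDisk →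
      ∃ T : BergmanSpace p α hp hα →L[ℂ] BergmanSpace p α hp hα,
        (∀ (f : BergmanSpace p α hp hα) (z : unitDisk),
          (T f) z = ψ z * f ⟨φ z, hφ z.2⟩) ∧
        essentialNorm T = ‖ψ a‖ / (φ' a).re ^ s ∧
        limsup (fun z => (weightQuotient φ ψ s z : EReal)) (𝓝[unitDisk] a) =
          ((‖ψ a‖ / (φ' a).re ^ s : ℝ) : EReal) ∧
        limsup (fun z => (weightQuotient φ ψ s z : EReal))
            (comap (fun z => ‖φ z‖) (𝓝 1) ⊓ 𝓟 unitDisk) =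
          ((‖ψ a‖ / (φ' a).re ^ s : ℝ) : EReal)) ∧
    (∀ (α s : ℝ), 0 < α → s = α →
      ∃ T : KorenblumSpace α →L[ℂ] KorenblumSpace α,
        (∀ (f : KorenblumSpace α) (z : unitDisk),
          (T f) z = ψ z * f ⟨φ z, hφ z.2⟩) ∧
        essentialNorm T = ‖ψ a‖ / (φ' a).re ^ s ∧
        limsup (fun z => (weightQuotient φ ψ s z : EReal)) (𝓝[unitDisk] a) =
          ((‖ψ a‖ / (φ' a).re ^ s : ℝ) : EReal) ∧
        limsup (fun z => (weightQuotient φ ψ s z : EReal))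
            (comap (fun z => ‖φ z‖) (𝓝 1) ⊓ 𝓟 unitDisk) =
          ((‖ψ a‖ / (φ' a).re ^ s : ℝ) : EReal)) := by
  -- Continuity up to the boundary, read as limits at `a` from within the disc.
  have hmem : a ∈ unitDisk ∪ (Metric.closedBall 0 1 ∩ Metric.ball a ρ) :=
    Or.inr ⟨mem_closedBall_zero_iff.2 ha.le, Metric.mem_ball_self hρ⟩
  have hc : Tendsto φ' (𝓝[unitDisk] a) (𝓝 (φ' a)) :=
    (hφ'c a hmem).mono_left (nhdsWithin_mono a subset_union_left)
  have hψt : Tendsto ψ (𝓝[unitDisk] a) (𝓝 (ψ a)) :=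
    (hψc a hmem).mono_left (nhdsWithin_mono a subset_union_left)
  have h := hasBoundaryDeriv_of_tendsto_deriv hφ hφ' ha hfix hc
  have haway : ∀ δ : ℝ, 0 < δ → ∃ r < 1, ∀ z ∈ unitDisk, δ ≤ ‖z - a‖ → ‖φ z‖ ≤ r :=
    fun δ hδ => exists_norm_le_of_limsup hφ h.diff hlim hδ
  rw [h.comap_norm_eq haway]
  refine ⟨⟨h.im_eq_zero, h.re_pos⟩, fun p α s hp hα hsp _ => ?_, fun α s hα hsα => ?_⟩
  · have hs : 0 < s := by
      rw [hsp]
      exact div_pos (by linarith) (by linarith)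
    have hN := isConformalNorm_bergman hp hα hsp
    have hX := isAnalyticSpace_bergman hp hα
    obtain ⟨T, hT⟩ := hX.exists_operator hN hs hφ h.diff hψ hψb
    refine ⟨T, hT, ?_, h.limsup_weightQuotient hs hψt, h.limsup_weightQuotient hs hψt⟩
    refine IsAnalyticSpace.essentialNorm_eq
      (fun η hη => hX.exists_isCompactOperator_norm_sub_le hN hs h haway hψ hψb hψt hT hη)
      fun L hL => hX.le_norm_sub_of_littleO hN h hψt (fun f F hF hfF => ?_) hT hL
    refine tendsto_norm_mul_of_bergman hp hα hsp ha hF fun htop => ?_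
    have h1 := hX.enorm_eq f
    rw [show bergmanEval p α hp hα f = fun z : unitDisk => F z from funext hfF] at h1
    have h2 : ENNReal.ofReal ((1 + α) / Real.pi) ≠ 0 := by
      have : 0 < (1 + α) / Real.pi := div_pos (by linarith) Real.pi_pos
      simpa using this
    rw [eLpNorm_weightedArea hp hα F, htop, ENNReal.mul_top h2,
      ENNReal.top_rpow_of_pos (by positivity)] at h1
    exact enorm_ne_top h1.symm
  · subst hsα
    have hN := isConformalNorm_weightedSup hα
    have hX := isAnalyticSpace_korenblum s
    obtain ⟨T, hT⟩ := hX.exists_operator hN hα hφ h.diff hψ hψb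
    refine ⟨T, hT, ?_, h.limsup_weightQuotient hα hψt, h.limsup_weightQuotient hα hψt⟩
    exact IsAnalyticSpace.essentialNorm_eq
      (fun η hη => hX.exists_isCompactOperator_norm_sub_le hN hα h haway hψ hψb hψt hT hη)
      fun L hL => hX.le_norm_sub_of_separated hN hα h hψt hψb
        (fun w hw k hk ε hε => eventually_norm_sub_testKernel_le hα ha hw hk hε) hT hL
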